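/- Let $d\ge 1$, let $|\cdot|$ be the maximum norm on $\mathbb Z^d$, and let $J:\mathbb Z^d\times\mathbb Z^d\to\mathbb R$ be a pairwise potential: $J(i,i)=0$, $J(i,j)=J(j,i)$ and $\sup_i\sum_j|J(i,j)|<\infty$. An Ising model with potential $J$ is a random element $X$ of $\{-1,1\}^{\mathbb Z^d}$ such that, for every site $i$ and every configuration $x$, a version of the conditional probability is $$\mathbb P\big(X(i)=x(i)\mid X(j)=x(j),\,j\ne i\big)=\frac{1}{1+\exp\big(-2\sum_{j}J(i,j)x(i)x(j)\big)} .$$ Let $X_1,X_2,\dots$ be independent copies of an Ising model with potential $J$. For a finite $F\subset\mathbb Z^d$, a site $j$ and a configuration $x$, put $$\hat p_n(x(F))=\frac1n\sum_{k=1}^n\mathbf 1\{X_k(F)=x(F)\},\qquad \hat p_n(x(j)\mid x(F\setminus\{j\}))=\frac{\hat p_n(x(F\cup\{j\}))}{\hat p_n(x(F\setminus\{j\}))},$$ the latter being $0$ if its denominator is $0$. With $B^L(i)=\{j:|i-j|\le L\}$ let, for $j\in B^L(i)$, $$\hat D_n(x(B^L(i)),j)=\big|\hat p_n(x(i)\mid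 x(B^L(i)\setminus\{i\}))-\hat p_n(x(i)\mid x(B^L(i)\setminus\{i,j\}))\big|\;\hat p_n(x(B^L(i)\setminus\{i\})),$$ and define the estimator with threshold $\epsilon$ by $$\hat V_n^{L}(i)=\Big\{j\in B^L(i):\max_{x(B^L(i))}\hat D_n(x(B^L(i)),j)>\epsilon\Big\}.$$ Assume that $$\sup_{i}\sum_{j}|J(i,j)|=r<1\qquad\text{and}\qquad \lim_{L\to\infty,\;L\in\mathbb N}\ \sup_{i}\sum_{j:\,|j-i|>L}|J(i,j)|\,e^{(2L)^d}=0 .$$ Let $C>0$ be an arbitrary constant, $L_n=\frac12(0.79\log n)^{1/d}$, and use the threshold $\epsilon=\epsilon(L_n,n)$, where $$\epsilon(L,n)=C\sqrt{\frac{(2L)^d}{n}\Big(\frac{1+e^2}{e^2}\Big)^{-(2L)^d}} .$$ Then for every $i\in\mathbb Z^d$: (i) for every $j$ with $J(i,j)\neq0$, $\lim_{n\to\infty}\mathbb P\big(j\in\hat V_n^{L_n}(i)\big)=1$; (ii) for every $j$ with $J(i,j)=0$, $\lim_{n\to\infty}\mathbb P\big(j\notin\hat V_n^{L_n}(i)\big)=1$.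 -/

import Mathlib

open MeasureTheory ProbabilityTheory Filter Topology
open scoped ENNReal

noncomputable section

namespace IsingNeighborhood

/-- Sites of the lattice `ℤ^d`; `‖·‖` on this type is the maximum norm. -/
abbrev Site (d : ℕ) : Type := Fin d → ℤ

/-- The basic binary set `{-1, 1}`. -/
abbrev Spin : Type := ({-1, 1} : Finset ℤ)

/-- Spin configurations on `ℤ^d`, with the product σ-algebra. -/
abbrev Config (d : ℕ) : Type := Site d → Spin

/-- The numerical value of a spin. -/
def spinVal (a : Spin) : ℝ := ((a : ℤ) : ℝ)

/-- Pairwise potentials. Sums of nonnegative terms are taken in `[0, ∞]`. -/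
structure IsPairwisePotential {d : ℕ} (J : Site d → Site d → ℝ) : Prop where
  diag_zero : ∀ i, J i i = 0
  symm : ∀ i j, J i j = J j i
  bounded : (⨆ i, ∑' j, ENNReal.ofReal |J i j|) < ∞

/-- The σ-algebra on configurations generated by the spins at all sites other than `i`. -/
abbrev sigmaOff {d : ℕ} (i : Site d) : MeasurableSpace (Config d) :=
  MeasurableSpace.comap (fun (x : Config d) (j : {j : Site d // j ≠ i}) => x j) inferInstance

theorem sigmaOff_le {d : ℕ} (i : Site d) :
    sigmaOff i ≤ (inferInstance : MeasurableSpace (Config d)) :=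
  Measurable.comap_le (measurable_pi_lambda _ fun j => measurable_pi_apply j.1)

/-- `μ` is the law of an Ising model with potential `J`: a version of the conditional probability
that the spin at `i` equals `a`, given the spins at all other sites, is
`1 / (1 + exp (-2 ∑ j, J i j * a * x j))`. -/
def IsIsingLaw {d : ℕ} (J : Site d → Site d → ℝ) (μ : Measure (Config d)) : Prop :=
  IsProbabilityMeasure μ ∧
    ∀ (i : Site d) (a : Spin),
      μ⟦{x : Config d | x i = a} | sigmaOff i⟧ =ᵐ[μ]
        fun x => 1 / (1 + Real.exp (-2 * ∑' j, J i j * spinVal a * spinVal (x j)))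

/-- The interaction neighborhood of the site `i`. -/
def interactionNbhd {d : ℕ} (J : Site d → Site d → ℝ) (i : Site d) : Set (Site d) :=
  {j | J i j ≠ 0}

/-- The ball of radius `L` around `i` in the maximum norm. -/
def box {d : ℕ} (L : ℝ) (i : Site d) : Set (Site d) := {j | ‖i - j‖ ≤ L}

/-- Configurations that agree with `x` on `F`. -/
def cyl {d : ℕ} (F : Set (Site d)) (x : Config d) : Set (Config d) := {y | ∀ j ∈ F, y j = x j}

/-- The empirical probability of `x(F)` in the sample `s 0, …, s (n-1)`. -/
def empProb {d : ℕ} (s : ℕ → Config d) (n : ℕ) (F : Set (Site d)) (x : Config d) : ℝ :=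
  (1 / (n : ℝ)) * ∑ k ∈ Finset.range n, (cyl F x).indicator (fun _ => (1 : ℝ)) (s k)

/-- The empirical conditional probability of `x(j)` given `x(F \ {j})`; it is `0` when the
denominator vanishes, by the convention for division in `ℝ`. -/
def empCond {d : ℕ} (s : ℕ → Config d) (n : ℕ) (j : Site d) (F : Set (Site d))
    (x : Config d) : ℝ :=
  empProb s n (F ∪ {j}) x / empProb s n (F \ {j}) x

/-- The empirical weighted distance between the conditional probabilities at `i` given the other
spins of the box, with and without the spin at `j`. It depends only on `x` restricted to the box. -/
def empDist {d : ℕ} (s : ℕ → Config d) (n : ℕ) (L : ℝ) (i : Site d) (x : Config d)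
    (j : Site d) : ℝ :=
  |empCond s n i (box L i \ {i}) x - empCond s n i (box L i \ {i, j}) x| *
    empProb s n (box L i \ {i}) x

/-- The interaction neighborhood estimator with threshold `ε`. The supremum is a maximum, since
`empDist` takes only finitely many values as `x` varies. -/
def estimator {d : ℕ} (s : ℕ → Config d) (n : ℕ) (L ε : ℝ) (i : Site d) : Set (Site d) :=
  {j | j ∈ box L i ∧ ε < ⨆ x : Config d, empDist s n L i x j}

/-- The threshold `ε(L, n)`. -/
def threshold (d : ℕ) (C L : ℝ) (n : ℕ) : ℝ :=
  C * √((2 * L) ^ d / (n : ℝ) *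
    ((1 + Real.exp 2) / Real.exp 2) ^ (-((2 * L) ^ d)))

/-- The radius `L_n = ½ (0.79 log n)^{1/d}`. -/
def radius (d n : ℕ) : ℝ := 1 / 2 * (0.79 * Real.log n) ^ (1 / (d : ℝ))

end IsingNeighborhood

end

open IsingNeighborhood

/-!
The conditional probability of a spin is the sigmoid of twice its local field, so reversing the spin
at `j` changes it by an amount bounded below when `J i j ≠ 0`. When `J i j = 0`, omitting `j` from
the box changes the conditional probability at `i` given the spins in the box by at most twice the
interaction of `i` with the complement of the box.

On a box with `M` sites every pattern has probability at most `q ^ M`, where `q < sigmoid 2` because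
the interaction at each site is at most `r < 1`, and some pattern has probability at least
`(1 / 2) ^ M`. Chernoff's bound for the at most `4 ^ M` events prescribed by patterns on subsets of
the box controls all empirical probabilities up to a multiple of the threshold `ε` as soon as
`M = o(n ε)` and `M q ^ M = o(n ε ^ 2)`. With `m = (2 L_n) ^ d = 0.79 log n` the quantities `n`,
`ε`, `q ^ M`, `(1 / 2) ^ M` and the tail of the interaction are exponential in `m` up to
subexponential factors, and the theorem reduces to comparing their rates. The constant `0.79` enters
through `-1 < (log (sigmoid 2) - 1 / 0.79) / 2 < -log 2`, which places `ε` strictly between the tail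
`exp (-m)` and the signal `2 ^ (-m)`.
-/

namespace IsingNeighborhood

section Sigmoid

open Real

theorem sigmoid_mul_one_sub_sigmoid_le (s : ℝ) : sigmoid s * (1 - sigmoid s) ≤ 1 / 4 := by
  nlinarith [sq_nonneg (sigmoid s - 1 / 2)]

theorem abs_sigmoid_sub_le (s t : ℝ) : |sigmoid s - sigmoid t| ≤ 1 / 4 * |s - t| := by
  refine convex_univ.norm_image_sub_le_of_norm_deriv_le (fun u _ => differentiable_sigmoid u)
    (fun u _ => ?_) (Set.mem_univ t) (Set.mem_univ s)
  have h_nonneg : 0 ≤ sigmoid u * (1 - sigmoid u) :=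
    mul_nonneg (sigmoid_pos u).le (sub_nonneg.2 (sigmoid_le_one u))
  rw [deriv_sigmoid, norm_of_nonneg h_nonneg]
  exact sigmoid_mul_one_sub_sigmoid_le u

theorem mul_abs_sub_le_abs_sigmoid_sub {R s t : ℝ} (hs : |s| ≤ R) (ht : |t| ≤ R) :
    sigmoid (-R) ^ 2 * |s - t| ≤ |sigmoid s - sigmoid t| := by
  wlog hts : t ≤ s generalizing s t
  · rw [abs_sub_comm s, abs_sub_comm (sigmoid s)]
    exact this ht hs (le_of_not_ge hts)
  rw [abs_of_nonneg (sub_nonneg.2 hts), abs_of_nonneg (sub_nonneg.2 (sigmoid_le hts))]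
  refine (convex_Icc (-R) R).mul_sub_le_image_sub_of_le_deriv continuous_sigmoid.continuousOn
    differentiable_sigmoid.differentiableOn (fun u hu => ?_) t (abs_le.1 ht) s (abs_le.1 hs) hts
  obtain ⟨hu_lower, hu_upper⟩ := interior_subset hu
  rw [deriv_sigmoid, sq]
  beta_reduce
  rw [← sigmoid_neg]
  exact mul_le_mul (sigmoid_le hu_lower) (sigmoid_le (neg_le_neg hu_upper))
    (sigmoid_pos _).le (sigmoid_pos _).le

end Sigmoid

variable {d : ℕ}

section Spins

theorem abs_spinVal (a : Spin) : |spinVal a| = 1 := by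
  obtain ⟨a, ha⟩ := a
  simp only [Finset.mem_insert, Finset.mem_singleton] at ha
  rcases ha with rfl | rfl <;> simp [spinVal]

/-- The other element of `{-1, 1}`. -/
def oppositeSpin (a : Spin) : Spin :=
  ⟨-a.1, by
    have ha := a.2
    simp only [Finset.mem_insert, Finset.mem_singleton] at ha ⊢
    omega⟩

theorem spinVal_oppositeSpin (a : Spin) : spinVal (oppositeSpin a) = -spinVal a := by
  simp [spinVal, oppositeSpin]

theorem eq_oppositeSpin_iff {a b : Spin} : b = oppositeSpin a ↔ b ≠ a := by
  obtain ⟨a, ha⟩ := a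
  obtain ⟨b, hb⟩ := b
  simp only [Finset.mem_insert, Finset.mem_singleton] at ha hb
  simp only [oppositeSpin, Ne, Subtype.mk.injEq]
  omega

/-- The configuration obtained from `x` by reversing the spin at `j`. -/
def flipAt (j : Site d) (x : Config d) : Config d := Function.update x j (oppositeSpin (x j))

theorem flipAt_self (j : Site d) (x : Config d) : flipAt j x j = oppositeSpin (x j) :=
  Function.update_self ..

theorem flipAt_of_ne {j k : Site d} (hkj : k ≠ j) (x : Config d) : flipAt j x k = x k :=
  Function.update_of_ne hkj ..

end Spins

section Field

/-- The local field at `i`, multiplied by the spin value `a`: half the logarithmic odds of seeing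
`a` at `i` when the spins at the other sites are given by `y`. -/
noncomputable def localField (J : Site d → Site d → ℝ) (i : Site d) (a : Spin) (y : Config d) :
    ℝ :=
  ∑' j, J i j * spinVal a * spinVal (y j)

/-- The conditional probability of the spin `a` at `i` prescribed by the potential `J`, given that
the spins at the other sites are those of `y`. -/
noncomputable def condSpinProb (J : Site d → Site d → ℝ) (i : Site d) (a : Spin) (y : Config d) :
    ℝ :=
  Real.sigmoid (2 * localField J i a y)

/-- The total strength of the interaction of `i` with the sites outside `F`. -/
noncomputable def interactionOutside (J : Site d → Site d → ℝ) (i : Site d) (F : Set (Site d)) :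
    ℝ :=
  ∑' k : ↥Fᶜ, |J i k|

variable {J : Site d → Site d → ℝ} {i : Site d}

theorem interactionOutside_nonneg (J : Site d → Site d → ℝ) (i : Site d) (F : Set (Site d)) :
    0 ≤ interactionOutside J i F :=
  tsum_nonneg fun _ => abs_nonneg _

theorem interactionOutside_insert {k : Site d} (hk : J i k = 0) (F : Set (Site d)) :
    interactionOutside J i (insert k F) = interactionOutside J i F := by
  classical
  simp only [interactionOutside, tsum_subtype _ fun m => |J i m|, Set.indicator_apply,
    Set.mem_compl_iff, Set.mem_insert_iff]
  congr 1 with m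
  by_cases hmk : m = k
  · simp [hmk, hk]
  · simp [hmk]

theorem abs_interaction_term (a b : Spin) (j : Site d) :
    |J i j * spinVal a * spinVal b| = |J i j| := by
  rw [abs_mul, abs_mul, abs_spinVal, abs_spinVal, mul_one, mul_one]

theorem summable_interaction (hs : Summable fun j => |J i j|) (a : Spin) (y : Config d) :
    Summable fun j => J i j * spinVal a * spinVal (y j) :=
  Summable.of_abs (by simpa only [abs_interaction_term] using hs)

theorem abs_localField_le (hs : Summable fun j => |J i j|) (a : Spin) (y : Config d) :
    |localField J i a y| ≤ ∑' j, |J i j| := by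
  have h := norm_tsum_le_tsum_norm (f := fun j => J i j * spinVal a * spinVal (y j))
    (by simpa only [Real.norm_eq_abs, abs_interaction_term] using hs)
  simpa only [localField, Real.norm_eq_abs, abs_interaction_term] using h

theorem abs_localField_sub_le (hs : Summable fun j => |J i j|) (a : Spin) {F : Set (Site d)}
    {x y : Config d} (hy : y ∈ cyl F x) :
    |localField J i a y - localField J i a x| ≤ 2 * interactionOutside J i F := by
  unfold localField interactionOutside
  rw [← (summable_interaction hs a y).tsum_sub (summable_interaction hs a x),
    tsum_subtype Fᶜ fun k => |J i k|, ← tsum_mul_left]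
  refine tsum_of_norm_bounded (f := fun k => J i k * spinVal a * spinVal (y k) -
    J i k * spinVal a * spinVal (x k)) ((hs.indicator Fᶜ).mul_left 2).hasSum fun k => ?_
  by_cases hk : k ∈ F
  · simp [hy k hk, hk]
  · rw [Set.indicator_of_mem (Set.mem_compl hk), Real.norm_eq_abs]
    refine (abs_sub _ _).trans_eq ?_
    rw [abs_interaction_term, abs_interaction_term, two_mul]

theorem localField_sub_localField_flipAt (hs : Summable fun j => |J i j|) (a : Spin)
    (x : Config d) (j : Site d) :
    localField J i a x - localField J i a (flipAt j x) =
      2 * (J i j * spinVal a * spinVal (x j)) := by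
  unfold localField
  rw [← (summable_interaction hs a x).tsum_sub (summable_interaction hs a _), tsum_eq_single j]
  · rw [flipAt_self, spinVal_oppositeSpin]; ring
  · intro k hk
    rw [flipAt_of_ne hk, sub_self]

theorem condSpinProb_le {r : ℝ} (hs : Summable fun j => |J i j|) (hr : ∑' j, |J i j| ≤ r)
    (a : Spin) (y : Config d) : condSpinProb J i a y ≤ Real.sigmoid (2 * r) := by
  have := (abs_le.1 ((abs_localField_le hs a y).trans hr)).2
  exact Real.sigmoid_le (by linarith)

theorem le_condSpinProb {r : ℝ} (hs : Summable fun j => |J i j|) (hr : ∑' j, |J i j| ≤ r)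
    (a : Spin) (y : Config d) : Real.sigmoid (-(2 * r)) ≤ condSpinProb J i a y := by
  have := (abs_le.1 ((abs_localField_le hs a y).trans hr)).1
  exact Real.sigmoid_le (by linarith)

theorem abs_condSpinProb_sub_le (hs : Summable fun j => |J i j|) (a : Spin) {F : Set (Site d)}
    {x y : Config d} (hy : y ∈ cyl F x) :
    |condSpinProb J i a y - condSpinProb J i a x| ≤ interactionOutside J i F :=
  calc |condSpinProb J i a y - condSpinProb J i a x|
      ≤ 1 / 4 * |2 * localField J i a y - 2 * localField J i a x| := abs_sigmoid_sub_le _ _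
    _ = 1 / 2 * |localField J i a y - localField J i a x| := by
        rw [← mul_sub, abs_mul, abs_two]; ring
    _ ≤ 1 / 2 * (2 * interactionOutside J i F) := by gcongr; exact abs_localField_sub_le hs a hy
    _ = interactionOutside J i F := by ring

theorem mul_abs_le_abs_condSpinProb_sub_flipAt {r : ℝ} (hs : Summable fun j => |J i j|)
    (hr : ∑' j, |J i j| ≤ r) (a : Spin) (x : Config d) (j : Site d) :
    Real.sigmoid (-(2 * r)) ^ 2 * (4 * |J i j|) ≤
      |condSpinProb J i a x - condSpinProb J i a (flipAt j x)| := by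
  have h_bound : ∀ y, |2 * localField J i a y| ≤ 2 * r := fun y => by
    rw [abs_mul, abs_two]
    exact mul_le_mul_of_nonneg_left ((abs_localField_le hs a y).trans hr) zero_le_two
  have h_field : |2 * localField J i a x - 2 * localField J i a (flipAt j x)| = 4 * |J i j| := by
    rw [← mul_sub, localField_sub_localField_flipAt hs, abs_mul, abs_mul, abs_two,
      abs_interaction_term]
    ring
  rw [← h_field]
  exact mul_abs_sub_le_abs_sigmoid_sub (h_bound x) (h_bound _)

end Field

section Cylinder

theorem measurableSet_spin_eq (i : Site d) (a : Spin) : MeasurableSet {y : Config d | y i = a} :=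
  measurableSet_eq_fun (measurable_pi_apply i) measurable_const

theorem measurableSet_cyl (F : Set (Site d)) (x : Config d) : MeasurableSet (cyl F x) := by
  have h : cyl F x = ⋂ j ∈ F, {y : Config d | y j = x j} := by ext y; simp [cyl]
  rw [h]
  exact MeasurableSet.biInter F.to_countable fun j _ => measurableSet_spin_eq j (x j)

theorem measurableSet_cyl_sigmaOff {i : Site d} {F : Set (Site d)} (hi : i ∉ F) (x : Config d) :
    MeasurableSet[sigmaOff i] (cyl F x) := by
  refine ⟨⋂ j ∈ {j : {j : Site d // j ≠ i} | j.1 ∈ F},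
    (fun y : {j : Site d // j ≠ i} → Spin => y j) ⁻¹' {x j},
    MeasurableSet.biInter (Set.to_countable _) fun j _ =>
      measurable_pi_apply j (measurableSet_singleton _), ?_⟩
  ext y
  simp only [Set.mem_preimage, Set.mem_iInter, Set.mem_singleton_iff, cyl, Set.mem_ofPred_eq,
    Subtype.forall]
  exact ⟨fun h j hj => h j (fun hji => hi (hji ▸ hj)) hj, fun h j _ hj => h j hj⟩

theorem cyl_insert (i : Site d) (F : Set (Site d)) (x : Config d) :
    cyl (insert i F) x = cyl F x ∩ {y | y i = x i} := by
  ext y; simp [cyl, and_comm]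

theorem cyl_congr {F : Set (Site d)} {x z : Config d} (h : ∀ k ∈ F, x k = z k) :
    cyl F x = cyl F z := by
  ext y
  exact forall₂_congr fun k hk => by rw [h k hk]

theorem cyl_anti {F G : Set (Site d)} (h : F ⊆ G) (x : Config d) : cyl G x ⊆ cyl F x :=
  fun _ hy k hk => hy k (h hk)

theorem cyl_flipAt {j : Site d} {F : Set (Site d)} (hj : j ∉ F) (x : Config d) :
    cyl F (flipAt j x) = cyl F x :=
  cyl_congr fun _ hk => flipAt_of_ne (ne_of_mem_of_not_mem hk hj) x

theorem cyl_insert_flipAt {j : Site d} {F : Set (Site d)} (hj : j ∉ F) (x : Config d) :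
    cyl (insert j F) (flipAt j x) = cyl F x \ {y | y j = x j} := by
  rw [cyl_insert, cyl_flipAt hj, flipAt_self]
  ext y
  simp [eq_oppositeSpin_iff]

theorem real_cyl_insert_add_flipAt (μ : Measure (Config d)) [IsFiniteMeasure μ] {j : Site d}
    {F : Set (Site d)} (hj : j ∉ F) (x : Config d) :
    μ.real (cyl (insert j F) x) + μ.real (cyl (insert j F) (flipAt j x)) = μ.real (cyl F x) := by
  rw [cyl_insert_flipAt hj, cyl_insert]
  exact measureReal_inter_add_sdiff (measurableSet_spin_eq j (x j))

theorem exists_one_half_pow_le_real_cyl (μ : Measure (Config d)) [IsProbabilityMeasure μ]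
    {F : Set (Site d)} (hF : F.Finite) : ∃ x, (1 / 2 : ℝ) ^ F.ncard ≤ μ.real (cyl F x) := by
  induction F, hF using Set.Finite.induction_on with
  | empty => exact ⟨fun _ => ⟨1, by simp⟩, by simp [cyl]⟩
  | @insert j F hj hF ih =>
    obtain ⟨x, hx⟩ := ih
    have h_split := real_cyl_insert_add_flipAt μ hj x
    rw [Set.ncard_insert_of_notMem hj hF, pow_succ]
    by_contra! h_small
    linarith [h_small x, h_small (flipAt j x)]

end Cylinder

namespace IsIsingLaw

variable {J : Site d → Site d → ℝ} {μ : Measure (Config d)}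

theorem condExp_ae_eq (hμ : IsIsingLaw J μ) (i : Site d) (a : Spin) :
    μ⟦{x : Config d | x i = a} | sigmaOff i⟧ =ᵐ[μ] condSpinProb J i a := by
  filter_upwards [hμ.2 i a] with y hy
  rw [hy, condSpinProb, localField, Real.sigmoid_def, one_div, neg_mul]

theorem integrable_condSpinProb (hμ : IsIsingLaw J μ) (i : Site d) (a : Spin) :
    Integrable (condSpinProb J i a) μ :=
  integrable_condExp.congr (hμ.condExp_ae_eq i a)

theorem real_cyl_insert (hμ : IsIsingLaw J μ) {i : Site d} {F : Set (Site d)} (hi : i ∉ F)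
    (x : Config d) :
    μ.real (cyl (insert i F) x) = ∫ y in cyl F x, condSpinProb J i (x i) y ∂μ := by
  have := hμ.1
  have hA := measurableSet_spin_eq i (x i)
  calc μ.real (cyl (insert i F) x)
      = ∫ y in cyl F x, {y : Config d | y i = x i}.indicator (fun _ => (1 : ℝ)) y ∂μ := by
        rw [setIntegral_indicator hA, cyl_insert]; simp
    _ = ∫ y in cyl F x, (μ⟦{y : Config d | y i = x i} | sigmaOff i⟧) y ∂μ :=
        (setIntegral_condExp (sigmaOff_le i) ((integrable_const _).indicator hA)
          (measurableSet_cyl_sigmaOff hi x)).symm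
    _ = ∫ y in cyl F x, condSpinProb J i (x i) y ∂μ :=
        setIntegral_congr_ae (measurableSet_cyl F x)
          ((hμ.condExp_ae_eq i (x i)).mono fun _ hy _ => hy)

theorem real_cyl_insert_le (hμ : IsIsingLaw J μ) {i : Site d} {F : Set (Site d)} (hi : i ∉ F)
    (x : Config d) {u : ℝ} (hu : ∀ y ∈ cyl F x, condSpinProb J i (x i) y ≤ u) :
    μ.real (cyl (insert i F) x) ≤ u * μ.real (cyl F x) := by
  have := hμ.1
  calc μ.real (cyl (insert i F) x) = ∫ y in cyl F x, condSpinProb J i (x i) y ∂μ :=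
        hμ.real_cyl_insert hi x
    _ ≤ ∫ _ in cyl F x, u ∂μ := setIntegral_mono_on
        (hμ.integrable_condSpinProb i _).integrableOn (integrable_const u).integrableOn
        (measurableSet_cyl F x) hu
    _ = u * μ.real (cyl F x) := by simp [mul_comm]

theorem le_real_cyl_insert (hμ : IsIsingLaw J μ) {i : Site d} {F : Set (Site d)} (hi : i ∉ F)
    (x : Config d) {l : ℝ} (hl : ∀ y ∈ cyl F x, l ≤ condSpinProb J i (x i) y) :
    l * μ.real (cyl F x) ≤ μ.real (cyl (insert i F) x) := by
  have := hμ.1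
  calc l * μ.real (cyl F x) = ∫ _ in cyl F x, l ∂μ := by simp [mul_comm]
    _ ≤ ∫ y in cyl F x, condSpinProb J i (x i) y ∂μ := setIntegral_mono_on
        (integrable_const l).integrableOn (hμ.integrable_condSpinProb i _).integrableOn
        (measurableSet_cyl F x) hl
    _ = μ.real (cyl (insert i F) x) := (hμ.real_cyl_insert hi x).symm

theorem real_cyl_le_pow (hμ : IsIsingLaw J μ) {r : ℝ} (hs : ∀ i, Summable fun j => |J i j|)
    (hr : ∀ i, ∑' j, |J i j| ≤ r) {F : Set (Site d)} (hF : F.Finite) (x : Config d) :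
    μ.real (cyl F x) ≤ Real.sigmoid (2 * r) ^ F.ncard := by
  have := hμ.1
  induction F, hF using Set.Finite.induction_on with
  | empty => simp [cyl]
  | @insert i F hi hF ih =>
    rw [Set.ncard_insert_of_notMem hi hF, pow_succ']
    exact (hμ.real_cyl_insert_le hi x fun y _ => condSpinProb_le (hs i) (hr i) _ y).trans
      (mul_le_mul_of_nonneg_left ih (Real.sigmoid_pos _).le)

theorem abs_real_cyl_insert_sub_le (hμ : IsIsingLaw J μ) {i : Site d}
    (hs : Summable fun j => |J i j|) {F : Set (Site d)} (hi : i ∉ F) (x : Config d) :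
    |μ.real (cyl (insert i F) x) - condSpinProb J i (x i) x * μ.real (cyl F x)| ≤
      interactionOutside J i F * μ.real (cyl F x) := by
  have h_freeze : ∀ y ∈ cyl F x,
      |condSpinProb J i (x i) y - condSpinProb J i (x i) x| ≤ interactionOutside J i F :=
    fun y hy => abs_condSpinProb_sub_le hs (x i) hy
  have h_upper := hμ.real_cyl_insert_le hi x
    (u := condSpinProb J i (x i) x + interactionOutside J i F)
    fun y hy => by linarith [(abs_le.1 (h_freeze y hy)).2]
  have h_lower := hμ.le_real_cyl_insert hi x
    (l := condSpinProb J i (x i) x - interactionOutside J i F)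
    fun y hy => by linarith [(abs_le.1 (h_freeze y hy)).1]
  exact abs_le.2 ⟨by linarith, by linarith⟩

end IsIsingLaw

section Chernoff

variable {Ω E : Type*} [MeasurableSpace Ω] [MeasurableSpace E] {P : Measure Ω}

theorem real_le_abs_le_of_mgf_le [IsFiniteMeasure P] {S : Ω → ℝ} {a t K : ℝ} (ht : 0 ≤ t)
    (h_int : ∀ s, Integrable (fun ω => Real.exp (s * S ω)) P) (h_pos : mgf S P t ≤ K)
    (h_neg : mgf S P (-t) ≤ K) :
    P.real {ω | a ≤ |S ω|} ≤ 2 * (Real.exp (-t * a) * K) := by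
  have h_upper : P.real {ω | a ≤ S ω} ≤ Real.exp (-t * a) * K :=
    (measure_ge_le_exp_mul_mgf a ht (h_int t)).trans (by gcongr)
  have h_lower : P.real {ω | S ω ≤ -a} ≤ Real.exp (-t * a) * K := by
    refine (measure_le_le_exp_mul_mgf (-a) (neg_nonpos.2 ht) (h_int (-t))).trans ?_
    rw [neg_mul_neg, neg_mul_comm]
    gcongr
  have h_subset : {ω | a ≤ |S ω|} ⊆ {ω | a ≤ S ω} ∪ {ω | S ω ≤ -a} :=
    fun _ hω => Or.imp id le_neg_of_le_neg (le_abs.1 (Set.mem_ofPred.1 hω))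
  calc P.real {ω | a ≤ |S ω|}
      ≤ P.real ({ω | a ≤ S ω} ∪ {ω | S ω ≤ -a}) :=
        measureReal_mono h_subset (measure_ne_top _ _)
    _ ≤ P.real {ω | a ≤ S ω} + P.real {ω | S ω ≤ -a} := measureReal_union_le _ _
    _ ≤ 2 * (Real.exp (-t * a) * K) := by linarith

/-- The indicator function of `A`, centered at its mean under `ν`. -/
noncomputable def centeredIndicator (ν : Measure E) (A : Set E) (y : E) : ℝ :=
  A.indicator (fun _ => 1) y - ν.real A

theorem measurable_centeredIndicator (ν : Measure E) {A : Set E} (hA : MeasurableSet A) :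
    Measurable (centeredIndicator ν A) :=
  (measurable_const.indicator hA).sub_const _

theorem centeredIndicator_mem_Icc (ν : Measure E) [IsProbabilityMeasure ν] (A : Set E) (y : E) :
    centeredIndicator ν A y ∈ Set.Icc (-1) 1 := by
  have h_nonneg : 0 ≤ ν.real A := measureReal_nonneg
  have h_le_one : ν.real A ≤ 1 := measureReal_le_one
  by_cases hy : y ∈ A <;> simp only [centeredIndicator, hy, Set.indicator_of_mem,
    Set.indicator_of_notMem, not_false_eq_true, Set.mem_Icc] <;> constructor <;> linarith

theorem mgf_centeredIndicator_le (ν : Measure E) [IsProbabilityMeasure ν] {A : Set E}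
    (hA : MeasurableSet A) {t : ℝ} (ht : |t| ≤ 1) :
    mgf (centeredIndicator ν A) ν t ≤ Real.exp (ν.real A * t ^ 2) := by
  set p := ν.real A with hp
  have h_exp : ∀ y, Real.exp (t * centeredIndicator ν A y) =
      Real.exp (-(t * p)) + A.indicator (fun _ => Real.exp (-(t * p)) * (Real.exp t - 1)) y := by
    intro y
    by_cases hy : y ∈ A
    · rw [centeredIndicator, Set.indicator_of_mem hy, Set.indicator_of_mem hy, ← hp,
        show t * (1 - p) = -(t * p) + t by ring, Real.exp_add]
      ring
    · rw [centeredIndicator, Set.indicator_of_notMem hy, Set.indicator_of_notMem hy, ← hp]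
      ring_nf
  calc mgf (centeredIndicator ν A) ν t
      = Real.exp (-(t * p)) * (p * (Real.exp t - 1) + 1) := by
        simp only [mgf, h_exp]
        rw [integral_add (integrable_const _) ((integrable_const _).indicator hA),
          integral_indicator hA]
        simp only [integral_const, probReal_univ, smul_eq_mul, one_mul,
          measureReal_restrict_apply_univ, ← hp]
        ring
    _ ≤ Real.exp (-(t * p)) * Real.exp (p * (Real.exp t - 1)) := by
        gcongr; exact Real.add_one_le_exp _
    _ = Real.exp (p * (Real.exp t - 1 - t)) := by rw [← Real.exp_add]; ring_nf
    _ ≤ Real.exp (p * t ^ 2) := by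
        gcongr
        exact (le_abs_self _).trans (Real.abs_exp_sub_one_sub_id_le ht)

/-- `X` is a sequence of independent random elements with common law `ν`. -/
structure IsIIDSample (X : ℕ → Ω → E) (P : Measure Ω) (ν : Measure E) : Prop where
  measurable : ∀ k, Measurable (X k)
  map_eq : ∀ k, P.map (X k) = ν
  indep : iIndepFun X P

theorem IsIIDSample.real_abs_sum_centeredIndicator_ge_le [IsProbabilityMeasure P]
    {X : ℕ → Ω → E} {ν : Measure E} (hX : IsIIDSample X P ν) {A : Set E} (hA : MeasurableSet A)
    {t : ℝ} (ht₀ : 0 ≤ t) (ht₁ : t ≤ 1) (n : ℕ) (δ : ℝ) :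
    P.real {ω | n * δ ≤ |∑ k ∈ Finset.range n, centeredIndicator ν A (X k ω)|} ≤
      2 * Real.exp (n * (ν.real A * t ^ 2 - t * δ)) := by
  have : IsProbabilityMeasure ν :=
    hX.map_eq 0 ▸ Measure.isProbabilityMeasure_map (hX.measurable 0).aemeasurable
  have h_meas := measurable_centeredIndicator ν hA
  set Z : ℕ → Ω → ℝ := fun k => centeredIndicator ν A ∘ X k
  have hZ_meas : ∀ k, Measurable (Z k) := fun k => h_meas.comp (hX.measurable k)
  have hZ_indep : iIndepFun Z P := hX.indep.comp (fun _ => centeredIndicator ν A)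
    fun _ => h_meas
  have hZ_mgf : ∀ k s, mgf (Z k) P s = mgf (centeredIndicator ν A) ν s := fun k s => by
    rw [← mgf_map (hX.measurable k).aemeasurable (h_meas.const_mul s).exp.aestronglyMeasurable,
      hX.map_eq k]
  have h_mgf : ∀ s : ℝ, |s| ≤ 1 → mgf (∑ k ∈ Finset.range n, Z k) P s ≤
      Real.exp (n * (ν.real A * s ^ 2)) := fun s hs => by
    simp only [hZ_indep.mgf_sum hZ_meas, hZ_mgf, Finset.prod_const, Finset.card_range,
      Real.exp_nat_mul]
    exact pow_le_pow_left₀ mgf_nonneg (mgf_centeredIndicator_le ν hA hs) n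
  have h_int : ∀ s, Integrable (fun ω => Real.exp (s * (∑ k ∈ Finset.range n, Z k) ω)) P :=
    fun s => hZ_indep.integrable_exp_mul_sum hZ_meas fun k _ =>
      integrable_exp_mul_of_mem_Icc (hZ_meas k).aemeasurable
        (ae_of_all _ fun ω => centeredIndicator_mem_Icc ν A (X k ω))
  have h_tail := real_le_abs_le_of_mgf_le (a := n * δ) ht₀ h_int
    (h_mgf t (by rwa [abs_of_nonneg ht₀]))
    (by simpa only [neg_sq] using h_mgf (-t) (by rwa [abs_neg, abs_of_nonneg ht₀]))
  rw [← Real.exp_add, show -t * (n * δ) + n * (ν.real A * t ^ 2) =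
    n * (ν.real A * t ^ 2 - t * δ) by ring] at h_tail
  simpa only [Finset.sum_apply, Z, Function.comp_apply] using h_tail

end Chernoff

section Concentration

/-- The sample `s 0, …, s (n-1)` estimates the probability under `μ` of every cylinder event over
a set of the family `𝓕` with error at most `δ`. -/
def IsTypical (μ : Measure (Config d)) (𝓕 : Set (Set (Site d))) (δ : ℝ) (s : ℕ → Config d)
    (n : ℕ) : Prop :=
  ∀ F ∈ 𝓕, ∀ x, |empProb s n F x - μ.real (cyl F x)| ≤ δ

variable {Ω : Type*} [MeasurableSpace Ω] {P : Measure Ω} [IsProbabilityMeasure P]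
  {μ : Measure (Config d)} {X : ℕ → Ω → Config d}

theorem mul_empProb_sub_real_cyl (μ : Measure (Config d)) (s : ℕ → Config d) {n : ℕ}
    (hn : n ≠ 0) (F : Set (Site d)) (x : Config d) :
    n * (empProb s n F x - μ.real (cyl F x)) =
      ∑ k ∈ Finset.range n, centeredIndicator μ (cyl F x) (s k) := by
  simp only [empProb, centeredIndicator, Finset.sum_sub_distrib, Finset.sum_const,
    Finset.card_range, nsmul_eq_mul]
  field_simp

theorem IsIIDSample.real_abs_empProb_sub_ge_le (hX : IsIIDSample X P μ) (F : Set (Site d))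
    (x : Config d) {t : ℝ} (ht₀ : 0 ≤ t) (ht₁ : t ≤ 1) {n : ℕ} (hn : n ≠ 0) (δ : ℝ) :
    P.real {ω | δ ≤ |empProb (fun k => X k ω) n F x - μ.real (cyl F x)|} ≤
      2 * Real.exp (n * (μ.real (cyl F x) * t ^ 2 - t * δ)) := by
  refine le_trans (measureReal_mono fun ω hω => ?_)
    (hX.real_abs_sum_centeredIndicator_ge_le (measurableSet_cyl F x) ht₀ ht₁ n δ)
  rw [Set.mem_ofPred_eq, ← mul_empProb_sub_real_cyl μ (fun k => X k ω) hn, abs_mul, Nat.abs_cast]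
  exact mul_le_mul_of_nonneg_left hω n.cast_nonneg

theorem exists_finset_forall_exists_mem_eq_on {B : Set (Site d)} (hB : B.Finite) :
    ∃ T : Finset (Config d),
      T.card ≤ 2 ^ B.ncard ∧ ∀ x : Config d, ∃ z ∈ T, ∀ k ∈ B, z k = x k := by
  classical
  induction B, hB using Set.Finite.induction_on with
  | empty => exact ⟨{fun _ => ⟨1, by simp⟩}, by simp⟩
  | @insert j B hj hB ih =>
    obtain ⟨T, hT_card, hT⟩ := ih
    refine ⟨T ∪ T.image (flipAt j), ?_, fun x => ?_⟩
    · have h_union := Finset.card_union_le T (T.image (flipAt j))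
      have h_image : (T.image (flipAt j)).card ≤ T.card := Finset.card_image_le
      rw [Set.ncard_insert_of_notMem hj hB, pow_succ]
      omega
    · obtain ⟨z, hz_mem, hz⟩ := hT x
      by_cases hzj : z j = x j
      · exact ⟨z, Finset.mem_union_left _ hz_mem, Set.forall_mem_insert.2 ⟨hzj, hz⟩⟩
      · refine ⟨flipAt j z, Finset.mem_union_right _ (Finset.mem_image_of_mem _ hz_mem),
          Set.forall_mem_insert.2 ⟨?_, fun k hk => ?_⟩⟩
        · rw [flipAt_self, eq_comm, eq_oppositeSpin_iff]
          exact Ne.symm hzj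
        · rw [flipAt_of_ne (ne_of_mem_of_not_mem hk hj), hz k hk]

theorem IsIIDSample.real_not_isTypical_le (hX : IsIIDSample X P μ) {B : Set (Site d)}
    (hB : B.Finite) {𝓕 : Set (Set (Site d))} (h𝓕 : 𝓕 ⊆ 𝒫 B) {p t δ : ℝ}
    (hp : ∀ F ∈ 𝓕, ∀ x, μ.real (cyl F x) ≤ p) (ht₀ : 0 ≤ t) (ht₁ : t ≤ 1) {n : ℕ} (hn : n ≠ 0) :
    P.real {ω | ¬ IsTypical μ 𝓕 δ (fun k => X k ω) n} ≤
      4 ^ B.ncard * (2 * Real.exp (n * (p * t ^ 2 - t * δ))) := by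
  obtain ⟨T, hT_card, hT⟩ := exists_finset_forall_exists_mem_eq_on hB
  have h𝓕_fin : 𝓕.Finite := hB.finite_subsets.subset h𝓕
  have h𝓕_card : h𝓕_fin.toFinset.card ≤ 2 ^ B.ncard := by
    rw [← Set.ncard_eq_toFinset_card 𝓕 h𝓕_fin, ← Set.ncard_powerset B hB]
    exact Set.ncard_le_ncard h𝓕 hB.finite_subsets
  set deviation : Set (Site d) × Config d → Set Ω := fun q =>
    {ω | δ ≤ |empProb (fun k => X k ω) n q.1 q.2 - μ.real (cyl q.1 q.2)|}
  have h_subset : {ω | ¬ IsTypical μ 𝓕 δ (fun k => X k ω) n} ⊆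
      ⋃ q ∈ h𝓕_fin.toFinset ×ˢ T, deviation q := by
    intro ω hω
    simp only [IsTypical, Set.mem_ofPred_eq, not_forall, not_le] at hω
    obtain ⟨F, hF, x, hx⟩ := hω
    obtain ⟨z, hz_mem, hz⟩ := hT x
    have h_cyl : cyl F z = cyl F x := cyl_congr fun k hk => hz k (h𝓕 hF hk)
    refine Set.mem_biUnion (x := (F, z)) (by simp [hF, hz_mem]) ?_
    simpa only [deviation, Set.mem_ofPred_eq, empProb, h_cyl] using hx.le
  calc P.real {ω | ¬ IsTypical μ 𝓕 δ (fun k => X k ω) n}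
      ≤ P.real (⋃ q ∈ h𝓕_fin.toFinset ×ˢ T, deviation q) :=
        measureReal_mono h_subset (measure_ne_top _ _)
    _ ≤ ∑ q ∈ h𝓕_fin.toFinset ×ˢ T, P.real (deviation q) := measureReal_biUnion_finset_le _ _
    _ ≤ ∑ _q ∈ h𝓕_fin.toFinset ×ˢ T, 2 * Real.exp (n * (p * t ^ 2 - t * δ)) := by
        refine Finset.sum_le_sum fun q hq => ?_
        have hq_le := hp q.1 (by simpa using (Finset.mem_product.1 hq).1) q.2
        refine (hX.real_abs_empProb_sub_ge_le q.1 q.2 ht₀ ht₁ hn δ).trans ?_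
        gcongr
    _ = (h𝓕_fin.toFinset.card * T.card : ℕ) * (2 * Real.exp (n * (p * t ^ 2 - t * δ))) := by
        rw [Finset.sum_const, Finset.card_product, nsmul_eq_mul]
    _ ≤ 4 ^ B.ncard * (2 * Real.exp (n * (p * t ^ 2 - t * δ))) := by
        gcongr
        calc ((h𝓕_fin.toFinset.card * T.card : ℕ) : ℝ)
            ≤ (2 ^ B.ncard * 2 ^ B.ncard : ℕ) := by gcongr
          _ = 4 ^ B.ncard := by rw [← mul_pow]; norm_num

theorem four_mul_exp_neg_three_lt_one : 4 * Real.exp (-3) < 1 := by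
  have := Real.exp_one_gt_d9
  rw [Real.exp_neg, ← div_eq_mul_inv, div_lt_one (Real.exp_pos 3),
    show (3 : ℝ) = (3 : ℕ) * 1 by norm_num, Real.exp_nat_mul]
  calc (4 : ℝ) < 2 ^ 3 := by norm_num
    _ < Real.exp 1 ^ 3 := by gcongr; linarith

theorem IsIIDSample.tendsto_real_not_isTypical (hX : IsIIDSample X P μ) {B : ℕ → Set (Site d)}
    {𝓕 : ℕ → Set (Set (Site d))} {p δ : ℕ → ℝ} (hB : ∀ n, (B n).Finite)
    (h𝓕 : ∀ᶠ n in atTop, 𝓕 n ⊆ 𝒫 (B n))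
    (hp : ∀ᶠ n in atTop, ∀ F ∈ 𝓕 n, ∀ x, μ.real (cyl F x) ≤ p n)
    (hδ : ∀ᶠ n in atTop, 0 < δ n) (hB_top : Tendsto (fun n => (B n).ncard) atTop atTop)
    (h_lin : (fun n => ((B n).ncard : ℝ)) =o[atTop] fun n => n * δ n)
    (h_quad : (fun n => (B n).ncard * p n) =o[atTop] fun n => n * δ n ^ 2) :
    Tendsto (fun n => P.real {ω | ¬ IsTypical μ (𝓕 n) (δ n) (fun k => X k ω) n}) atTop (𝓝 0) := by
  have h_bound : Tendsto (fun n => 2 * (4 * Real.exp (-3)) ^ (B n).ncard) atTop (𝓝 0) := by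
    simpa using ((tendsto_pow_atTop_nhds_zero_of_lt_one (by positivity)
      four_mul_exp_neg_three_lt_one).comp hB_top).const_mul 2
  refine squeeze_zero' (Eventually.of_forall fun _ => measureReal_nonneg) ?_ h_bound
  filter_upwards [h𝓕, hp, hδ, h_lin.bound (show (0 : ℝ) < 1 / 4 by norm_num),
    h_quad.bound (show (0 : ℝ) < 1 / 16 by norm_num), eventually_ne_atTop 0]
    with n h𝓕n hpn hδn h_lin_n h_quad_n hn
  have hn_pos : (0 : ℝ) < n := by positivity
  have h_den : 0 < n * δ n := mul_pos hn_pos hδn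
  rw [Real.norm_of_nonneg (by positivity), Real.norm_of_nonneg (by positivity)] at h_lin_n
  rw [Real.norm_of_nonneg (by positivity : 0 ≤ (n : ℝ) * δ n ^ 2)] at h_quad_n
  set M : ℝ := ((B n).ncard : ℝ) with hM
  -- The choice `t = 4M/(nδ)` makes the linear term of the exponent equal to `-4M`.
  set t := 4 * M / (n * δ n) with ht
  have ht_le : t ≤ 1 := (div_le_one h_den).2 (by linarith)
  have h_exponent : n * (p n * t ^ 2 - t * δ n) ≤ -3 * M := by
    have h_quad_le : 16 * (M * p n) / (n * δ n ^ 2) ≤ 1 :=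
      (div_le_one (by positivity)).2 (by linarith [(le_abs_self _).trans h_quad_n])
    calc n * (p n * t ^ 2 - t * δ n) = M * (16 * (M * p n) / (n * δ n ^ 2)) - 4 * M := by
          rw [ht]; field_simp; ring
      _ ≤ M * 1 - 4 * M := by gcongr
      _ = -3 * M := by ring
  refine (hX.real_not_isTypical_le (hB n) h𝓕n hpn (by positivity) ht_le hn).trans ?_
  calc 4 ^ (B n).ncard * (2 * Real.exp (n * (p n * t ^ 2 - t * δ n)))
      ≤ 4 ^ (B n).ncard * (2 * Real.exp (-3 * M)) := by gcongr
    _ = 2 * (4 * Real.exp (-3)) ^ (B n).ncard := by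
        rw [mul_pow, ← Real.exp_nat_mul, mul_comm (-3 : ℝ), ← hM]; ring

end Concentration

section Empirical

variable {s : ℕ → Config d} {n : ℕ} {L ε δ : ℝ} {i j : Site d} {μ : Measure (Config d)}

theorem empProb_nonneg (s : ℕ → Config d) (n : ℕ) (F : Set (Site d)) (x : Config d) :
    0 ≤ empProb s n F x :=
  mul_nonneg (by positivity) (Finset.sum_nonneg fun _ _ => Set.indicator_nonneg (by simp) _)

theorem empProb_anti (s : ℕ → Config d) (n : ℕ) {F G : Set (Site d)} (h : F ⊆ G) (x : Config d) :
    empProb s n G x ≤ empProb s n F x :=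
  mul_le_mul_of_nonneg_left (Finset.sum_le_sum fun _ _ =>
    Set.indicator_le_indicator_of_subset (cyl_anti h x) (fun _ => zero_le_one) _) (by positivity)

theorem empProb_le_one (s : ℕ → Config d) (n : ℕ) (F : Set (Site d)) (x : Config d) :
    empProb s n F x ≤ 1 := by
  have h_sum : ∑ k ∈ Finset.range n, (cyl F x).indicator (fun _ => (1 : ℝ)) (s k) ≤ n :=
    calc ∑ k ∈ Finset.range n, (cyl F x).indicator (fun _ => (1 : ℝ)) (s k)
        ≤ ∑ _k ∈ Finset.range n, (1 : ℝ) := Finset.sum_le_sum fun k _ =>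
          Set.indicator_le_self' (f := fun _ => (1 : ℝ)) (fun _ _ => zero_le_one) (s k)
      _ = n := by simp
  rw [empProb, one_div, inv_mul_eq_div]
  exact div_le_one_of_le₀ h_sum (by positivity)

theorem empCond_mem_Icc (s : ℕ → Config d) (n : ℕ) (j : Site d) (F : Set (Site d))
    (x : Config d) : empCond s n j F x ∈ Set.Icc 0 1 :=
  ⟨div_nonneg (empProb_nonneg ..) (empProb_nonneg ..),
    div_le_one_of_le₀ (empProb_anti s n (Set.sdiff_subset.trans Set.subset_union_left) x)
      (empProb_nonneg ..)⟩

theorem empDist_le_one (s : ℕ → Config d) (n : ℕ) (L : ℝ) (i : Site d) (x : Config d)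
    (j : Site d) : empDist s n L i x j ≤ 1 :=
  mul_le_one₀ (Real.dist_le_of_mem_Icc_01 (empCond_mem_Icc ..) (empCond_mem_Icc ..))
    (empProb_nonneg ..) (empProb_le_one ..)

theorem empDist_self (s : ℕ → Config d) (n : ℕ) (L : ℝ) (i : Site d) (x : Config d) :
    empDist s n L i x i = 0 := by
  simp [empDist]

theorem mem_estimator_of_lt_empDist (hj : j ∈ box L i) {x : Config d}
    (hx : ε < empDist s n L i x j) : j ∈ estimator s n L ε i :=
  ⟨hj, hx.trans_le (le_ciSup (f := fun x => empDist s n L i x j)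
    ⟨1, Set.forall_mem_range.2 fun x => empDist_le_one s n L i x j⟩ x)⟩

theorem notMem_estimator_of_forall_empDist_le (hε : 0 ≤ ε)
    (h : j ∈ box L i → ∀ x, empDist s n L i x j ≤ ε) : j ∉ estimator s n L ε i :=
  fun hj => hj.2.not_ge (Real.iSup_le (h hj.1) hε)

/-- The error made in estimating `q` by `c / e` is harmless where `e` is small, because the weight
`b` does not exceed `e`. -/
theorem abs_weighted_ratio_sub_le {a b c e : ℝ} (q : ℝ) (ha : 0 ≤ a) (hab : a ≤ b)
    (hbe : b ≤ e) : |(|a / b - c / e| * b) - (|a - q * b|)| ≤ |c - q * e| := by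
  rcases (ha.trans hab).eq_or_lt with rfl | hb
  · simp [le_antisymm hab ha]
  have he : 0 < e := hb.trans_le hbe
  have h_weight : |a / b - c / e| * b = |a - b * (c / e)| := by
    conv_lhs => rw [← abs_of_pos hb, ← abs_mul, abs_of_pos hb]
    congr 1
    field_simp
  have h_diff : a - b * (c / e) - (a - q * b) = -(b / e) * (c - q * e) := by field_simp; ring
  calc |(|a / b - c / e| * b) - (|a - q * b|)|
      ≤ |a - b * (c / e) - (a - q * b)| := h_weight ▸ abs_abs_sub_abs_le_abs_sub _ _
    _ = b / e * |c - q * e| := by rw [h_diff, abs_mul, abs_neg, abs_of_pos (div_pos hb he)]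
    _ ≤ |c - q * e| := mul_le_of_le_one_left (abs_nonneg _) ((div_le_one he).2 hbe)

theorem IsTypical.abs_sub_mul_empProb_le {𝓕 : Set (Set (Site d))} (hs : IsTypical μ 𝓕 δ s n)
    {F F' : Set (Site d)} (hF : F ∈ 𝓕) (hF' : F' ∈ 𝓕) {q : ℝ} (hq : q ∈ Set.Icc 0 1)
    (x : Config d) :
    |(|empProb s n F x - q * empProb s n F' x|) -
      (|μ.real (cyl F x) - q * μ.real (cyl F' x)|)| ≤ 2 * δ := by
  have h_err : q * |empProb s n F' x - μ.real (cyl F' x)| ≤ 1 * δ :=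
    mul_le_mul hq.2 (hs F' hF' x) (abs_nonneg _) zero_le_one
  calc |(|empProb s n F x - q * empProb s n F' x|) - (|μ.real (cyl F x) - q * μ.real (cyl F' x)|)|
      ≤ |empProb s n F x - q * empProb s n F' x - (μ.real (cyl F x) - q * μ.real (cyl F' x))| :=
        abs_abs_sub_abs_le_abs_sub _ _
    _ = |empProb s n F x - μ.real (cyl F x) - q * (empProb s n F' x - μ.real (cyl F' x))| := by
        ring_nf
    _ ≤ |empProb s n F x - μ.real (cyl F x)| + q * |empProb s n F' x - μ.real (cyl F' x)| := by
        rw [← abs_of_nonneg hq.1, ← abs_mul, abs_of_nonneg hq.1]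
        exact abs_sub _ _
    _ ≤ 2 * δ := by linarith [hs F hF x]

variable {G : Set (Site d)}

theorem empDist_eq (s : ℕ → Config d) (n : ℕ) (hbox : box L i = insert i (insert j G))
    (hi : i ∉ insert j G) (hj : j ∉ G) (x : Config d) :
    empDist s n L i x j =
      |empProb s n (insert i (insert j G)) x / empProb s n (insert j G) x -
        empProb s n (insert i G) x / empProb s n G x| * empProb s n (insert j G) x := by
  have hiG : i ∉ G := fun h => hi (Set.mem_insert_of_mem j h)
  have h_sdiff_i : box L i \ {i} = insert j G := by rw [hbox, Set.insert_sdiff_self_of_notMem hi]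
  have h_sdiff_ij : box L i \ {i, j} = G := by
    rw [← Set.singleton_union, ← Set.sdiff_sdiff, h_sdiff_i, Set.insert_sdiff_self_of_notMem hj]
  rw [empDist, empCond, empCond, h_sdiff_i, h_sdiff_ij, Set.sdiff_singleton_eq_self hi,
    Set.sdiff_singleton_eq_self hiG, Set.union_singleton, Set.union_singleton]

theorem IsTypical.abs_empDist_sub_le (hs : IsTypical μ (Set.Icc G (box L i)) δ s n)
    (hbox : box L i = insert i (insert j G)) (hi : i ∉ insert j G) (hj : j ∉ G) {q : ℝ}
    (hq : q ∈ Set.Icc 0 1) (x : Config d) :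
    |empDist s n L i x j - (|μ.real (cyl (box L i) x) - q * μ.real (cyl (insert j G) x)|)| ≤
      4 * δ + |μ.real (cyl (insert i G) x) - q * μ.real (cyl G x)| := by
  have hjG : G ⊆ insert j G := Set.subset_insert j G
  have hjG_box : insert j G ⊆ box L i := hbox ▸ Set.subset_insert i _
  have hiG_box : insert i G ⊆ box L i := hbox ▸ Set.insert_subset_insert hjG
  have h_ratio := abs_weighted_ratio_sub_le q (empProb_nonneg s n (box L i) x)
    (empProb_anti s n hjG_box x) (empProb_anti s n hjG x) (c := empProb s n (insert i G) x)
  nth_rewrite 1 [hbox] at h_ratio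
  rw [← empDist_eq s n hbox hi hj] at h_ratio
  have h_with := hs.abs_sub_mul_empProb_le ⟨hjG.trans hjG_box, le_rfl⟩ ⟨hjG, hjG_box⟩ hq x
  have h_without := hs.abs_sub_mul_empProb_le ⟨Set.subset_insert i G, hiG_box⟩
    ⟨le_rfl, hjG.trans hjG_box⟩ hq x
  rw [abs_le] at h_ratio h_with h_without ⊢
  constructor <;> linarith

end Empirical

section Separation

variable {J : Site d → Site d → ℝ} {μ : Measure (Config d)} {s : ℕ → Config d} {n : ℕ}
  {L δ : ℝ} {i j : Site d} {G : Set (Site d)}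

theorem IsIsingLaw.empDist_le (hμ : IsIsingLaw J μ) (hsum : Summable fun k => |J i k|)
    (hii : J i i = 0) (hij : J i j = 0) (hbox : box L i = insert i (insert j G))
    (hi : i ∉ insert j G) (hj : j ∉ G) (hs : IsTypical μ (Set.Icc G (box L i)) δ s n)
    (x : Config d) : empDist s n L i x j ≤ 4 * δ + 2 * interactionOutside J i (box L i) := by
  have := hμ.1
  have hiG : i ∉ G := fun h => hi (Set.mem_insert_of_mem j h)
  have h_with := hμ.abs_real_cyl_insert_sub_le hsum hi x
  have h_without := hμ.abs_real_cyl_insert_sub_le hsum hiG x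
  rw [← hbox] at h_with
  have h_outside : interactionOutside J i (box L i) = interactionOutside J i G := by
    rw [hbox, interactionOutside_insert hii, interactionOutside_insert hij]
  rw [interactionOutside_insert hij] at h_with
  have h_emp := (abs_le.1 (hs.abs_empDist_sub_le hbox hi hj (q := condSpinProb J i (x i) x)
    ⟨(Real.sigmoid_pos _).le, Real.sigmoid_le_one _⟩ x)).2
  have h_le : ∀ F, interactionOutside J i G * μ.real (cyl F x) ≤ interactionOutside J i G :=
    fun F => mul_le_of_le_one_right (interactionOutside_nonneg J i G) measureReal_le_one
  linarith [h_le G, h_le (insert j G)]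

theorem sub_mul_mul_le_abs_mul_sub_mul {σ σ' θ u u' v v' : ℝ} (hu : 0 ≤ u) (hu' : 0 ≤ u')
    (hv : |v - σ * u| ≤ θ * u) (hv' : |v' - σ' * u'| ≤ θ * u') :
    (|σ - σ'| - 2 * θ) * (u * u') ≤ |v * u' - v' * u| := by
  have h_split : (σ - σ') * (u * u') =
      (v * u' - v' * u) - (v - σ * u) * u' + (v' - σ' * u') * u := by ring
  have h_abs : |σ - σ'| * (u * u') ≤ |v * u' - v' * u| + θ * u * u' + θ * u' * u :=
    calc |σ - σ'| * (u * u') = |(σ - σ') * (u * u')| := by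
          rw [abs_mul, abs_of_nonneg (mul_nonneg hu hu')]
      _ ≤ |v * u' - v' * u| + |v - σ * u| * u' + |v' - σ' * u'| * u := by
          rw [h_split, ← abs_of_nonneg hu', ← abs_mul, ← abs_of_nonneg hu, ← abs_mul,
            abs_of_nonneg hu, abs_of_nonneg hu']
          exact (abs_add_le _ _).trans (add_le_add_left (abs_sub _ _) _)
      _ ≤ |v * u' - v' * u| + θ * u * u' + θ * u' * u := by gcongr
  linarith

theorem mul_mul_le_abs_sub_div_mul {κ l u u' v v' : ℝ} (hκ : 0 ≤ κ) (hu : 0 ≤ u) (hu' : 0 ≤ u')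
    (hl : l * (u + u') ≤ u') (h : κ * (u * u') ≤ |v * u' - v' * u|) :
    κ * l * u ≤ |v - (v + v') / (u + u') * u| := by
  rcases hu.eq_or_lt with rfl | hu_pos
  · simp
  have h_sum : 0 < u + u' := by linarith
  have h_eq : v - (v + v') / (u + u') * u = (v * u' - v' * u) / (u + u') := by
    field_simp; ring
  rw [h_eq, abs_div, abs_of_pos h_sum, le_div_iff₀ h_sum]
  calc κ * l * u * (u + u') = κ * u * (l * (u + u')) := by ring
    _ ≤ κ * u * u' := by gcongr
    _ ≤ |v * u' - v' * u| := by rwa [mul_assoc]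

theorem IsIsingLaw.mul_real_cyl_le_abs_sub (hμ : IsIsingLaw J μ) {r κ : ℝ}
    (hsum : ∀ i, Summable fun k => |J i k|) (hr : ∀ i, ∑' k, |J i k| ≤ r) (hκ : 0 ≤ κ)
    (hκ_le : κ + 2 * interactionOutside J i (insert j G) ≤
      Real.sigmoid (-(2 * r)) ^ 2 * (4 * |J i j|)) (hi : i ∉ insert j G) (hj : j ∉ G)
    (x : Config d) :
    κ * Real.sigmoid (-(2 * r)) * μ.real (cyl (insert j G) x) ≤
      |μ.real (cyl (insert i (insert j G)) x) -
        μ.real (cyl (insert i G) x) / μ.real (cyl G x) * μ.real (cyl (insert j G) x)| := by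
  have := hμ.1
  have hij : i ≠ j := fun h => hi (h ▸ Set.mem_insert i G)
  have hj_insert : j ∉ insert i G := by simp [hij.symm, hj]
  have h_flip := hμ.abs_real_cyl_insert_sub_le (hsum i) hi (flipAt j x)
  have h_lower := hμ.le_real_cyl_insert hj (flipAt j x) fun y _ =>
    le_condSpinProb (hsum j) (hr j) _ y
  rw [flipAt_of_ne hij] at h_flip
  rw [cyl_flipAt hj, ← real_cyl_insert_add_flipAt μ hj x] at h_lower
  rw [← real_cyl_insert_add_flipAt μ hj x, ← real_cyl_insert_add_flipAt μ hj_insert x,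
    Set.insert_comm j i]
  refine mul_mul_le_abs_sub_div_mul hκ measureReal_nonneg measureReal_nonneg h_lower
    (le_trans ?_ (sub_mul_mul_le_abs_mul_sub_mul measureReal_nonneg measureReal_nonneg
      (hμ.abs_real_cyl_insert_sub_le (hsum i) hi x) h_flip))
  have h_gap := mul_abs_le_abs_condSpinProb_sub_flipAt (hsum i) (hr i) (x i) x j
  exact mul_le_mul_of_nonneg_right (by linarith) (mul_nonneg measureReal_nonneg measureReal_nonneg)

theorem IsIsingLaw.exists_le_empDist (hμ : IsIsingLaw J μ) {r κ : ℝ}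
    (hsum : ∀ i, Summable fun k => |J i k|) (hr : ∀ i, ∑' k, |J i k| ≤ r) (hii : J i i = 0)
    (hκ : 0 ≤ κ) (hκ_le : κ + 2 * interactionOutside J i (box L i) ≤
      Real.sigmoid (-(2 * r)) ^ 2 * (4 * |J i j|)) (hbox : box L i = insert i (insert j G))
    (hfin : (box L i).Finite) (hi : i ∉ insert j G) (hj : j ∉ G)
    (hs : IsTypical μ (Set.Icc G (box L i)) δ s n) :
    ∃ x, κ * Real.sigmoid (-(2 * r)) * (1 / 2) ^ (box L i).ncard - 4 * δ ≤
      empDist s n L i x j := by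
  have := hμ.1
  obtain ⟨x, hx⟩ := exists_one_half_pow_le_real_cyl μ hfin
  have h_anti : μ.real (cyl (insert i G) x) ≤ μ.real (cyl G x) :=
    measureReal_mono (cyl_anti (Set.subset_insert i G) x)
  set q := μ.real (cyl (insert i G) x) / μ.real (cyl G x)
  have hq : q ∈ Set.Icc 0 1 := ⟨by positivity, div_le_one_of_le₀ h_anti measureReal_nonneg⟩
  have hq_mul : q * μ.real (cyl G x) = μ.real (cyl (insert i G) x) :=
    div_mul_cancel_of_imp fun h => le_antisymm (h ▸ h_anti) measureReal_nonneg
  have h_emp := (abs_le.1 (hs.abs_empDist_sub_le hbox hi hj hq x)).1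
  rw [hq_mul, sub_self, abs_zero] at h_emp
  have h_cyl : (1 / 2) ^ (box L i).ncard ≤ μ.real (cyl (insert j G) x) :=
    hx.trans (measureReal_mono (cyl_anti (hbox ▸ Set.subset_insert i _) x))
  have h_gap : κ * Real.sigmoid (-(2 * r)) * μ.real (cyl (insert j G) x) ≤
      |μ.real (cyl (box L i) x) - q * μ.real (cyl (insert j G) x)| := by
    rw [hbox, interactionOutside_insert hii] at hκ_le
    rw [hbox]
    exact hμ.mul_real_cyl_le_abs_sub hsum hr hκ hκ_le hi hj x
  have h_weight := mul_le_mul_of_nonneg_left h_cyl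
    (mul_nonneg hκ (Real.sigmoid_pos (-(2 * r))).le)
  exact ⟨x, by linarith⟩

end Separation

section Box

variable {L : ℝ} {i j : Site d}

theorem box_eq_closedBall (L : ℝ) (i : Site d) : box L i = Metric.closedBall i L := by
  ext j
  simp only [box, Set.mem_ofPred_eq, Metric.mem_closedBall', dist_eq_norm]

theorem finite_box (L : ℝ) (i : Site d) : (box L i).Finite :=
  (box_eq_closedBall L i ▸ isCompact_closedBall i L).finite_of_discrete

theorem box_mono (i : Site d) : Monotone fun L => box L i := fun _ _ h _ hj => hj.trans h

theorem self_mem_box (hL : 0 ≤ L) (i : Site d) : i ∈ box L i :=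
  (norm_sub_rev i i).trans_le (by simpa using hL)

theorem mem_box_iff_abs_le_floor (hL : 0 ≤ L) (i j : Site d) :
    j ∈ box L i ↔ ∀ k, |i k - j k| ≤ (⌊L⌋₊ : ℤ) := by
  simp only [box, Set.mem_ofPred_eq, pi_norm_le_iff_of_nonneg hL]
  refine forall_congr' fun k => ?_
  rw [Pi.sub_apply, Int.norm_eq_abs, Int.abs_eq_natAbs, Nat.cast_le, Nat.le_floor_iff hL,
    ← Int.cast_abs, Int.abs_eq_natAbs, Int.cast_natCast]

theorem box_floor (hL : 0 ≤ L) (i : Site d) : box (⌊L⌋₊ : ℝ) i = box L i := by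
  ext j
  rw [mem_box_iff_abs_le_floor (Nat.cast_nonneg _), mem_box_iff_abs_le_floor hL, Nat.floor_natCast]

theorem box_eq_Icc (hL : 0 ≤ L) (i : Site d) :
    box L i = Finset.Icc (fun k => i k - (⌊L⌋₊ : ℤ)) (fun k => i k + (⌊L⌋₊ : ℤ)) := by
  ext j
  rw [mem_box_iff_abs_le_floor hL, Finset.coe_Icc, Set.mem_Icc, Pi.le_def, Pi.le_def, ← forall_and]
  refine forall_congr' fun k => ?_
  rw [abs_le, neg_le_sub_iff_le_add, sub_le_iff_le_add, sub_le_iff_le_add, and_comm,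
    add_comm (⌊L⌋₊ : ℤ)]

/-- The number of sites in a box of radius `L ≥ 0` in `ℤ^d`. -/
noncomputable def boxVolume (d : ℕ) (L : ℝ) : ℕ := (2 * ⌊L⌋₊ + 1) ^ d

theorem ncard_box (hL : 0 ≤ L) (i : Site d) : (box L i).ncard = boxVolume d L := by
  have h_side (k : Fin d) :
      (Finset.Icc (i k - (⌊L⌋₊ : ℤ)) (i k + (⌊L⌋₊ : ℤ))).card = 2 * ⌊L⌋₊ + 1 := by
    rw [Int.card_Icc]
    omega
  rw [box_eq_Icc hL, Set.ncard_coe_finset, Pi.card_Icc]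
  simp only [h_side, Finset.prod_const, Finset.card_univ, Fintype.card_fin, boxVolume]

theorem box_eq_insert_insert (hj : j ∈ box L i) :
    box L i = insert i (insert j (box L i \ {i, j})) := by
  have hi : i ∈ box L i := self_mem_box ((norm_nonneg _).trans hj) i
  rw [← Set.singleton_union (a := j), ← Set.insert_union,
    Set.union_sdiff_cancel (Set.pair_subset hi hj)]

variable {ι : Type*} {l : Filter ι} {L : ι → ℝ}

theorem tendsto_boxVolume (hd : 1 ≤ d) (hL : Tendsto L l atTop) :
    Tendsto (fun n => boxVolume d (L n)) l atTop :=
  tendsto_atTop_mono (fun n => (show ⌊L n⌋₊ ≤ 2 * ⌊L n⌋₊ + 1 by omega).trans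
    (Nat.le_self_pow (by omega) _)) (tendsto_nat_floor_atTop.comp hL)

theorem tendsto_interactionOutside_box {J : Site d → Site d → ℝ} {i : Site d}
    (hL : Tendsto L l atTop) :
    Tendsto (fun n => interactionOutside J i (box (L n) i)) l (𝓝 0) := by
  have h_box : Tendsto (fun R => (finite_box R i).toFinset) atTop atTop :=
    tendsto_atTop_finset_of_monotone
      (fun _ _ h => Set.Finite.toFinset_mono (box_mono i h))
      fun j => ⟨‖i - j‖, (Set.Finite.mem_toFinset _).2 (le_refl ‖i - j‖)⟩
  refine ((tendsto_tsum_compl_atTop_zero fun j => |J i j|).comp (h_box.comp hL)).congr fun n => ?_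
  change interactionOutside J i (finite_box (L n) i).toFinset = _
  rw [Set.Finite.coe_toFinset]

end Box

theorem IsIsingLaw.real_cyl_le_pow_div {J : Site d → Site d → ℝ} {μ : Measure (Config d)}
    (hμ : IsIsingLaw J μ) {r : ℝ} (hs : ∀ i, Summable fun j => |J i j|)
    (hr : ∀ i, ∑' j, |J i j| ≤ r) {B F : Set (Site d)} (hB : B.Finite) {i j : Site d}
    (hF : F ∈ Set.Icc (B \ {i, j}) B) (x : Config d) :
    μ.real (cyl F x) ≤ Real.sigmoid (2 * r) ^ B.ncard / Real.sigmoid (2 * r) ^ 2 := by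
  have hF_fin : F.Finite := hB.subset hF.2
  have h_card : B.ncard ≤ F.ncard + 2 :=
    calc B.ncard ≤ (F ∪ {i, j}).ncard := Set.ncard_le_ncard
          (Set.sdiff_subset_iff.1 hF.1 |>.trans_eq (Set.union_comm _ _))
          (hF_fin.union (Set.toFinite _))
      _ ≤ F.ncard + ({i, j} : Set (Site d)).ncard := Set.ncard_union_le _ _
      _ ≤ F.ncard + 2 := add_le_add_right (Set.ncard_insert_le _ _ |>.trans_eq (by simp)) _
  rw [le_div_iff₀ (pow_pos (Real.sigmoid_pos _) 2)]
  calc μ.real (cyl F x) * Real.sigmoid (2 * r) ^ 2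
      ≤ Real.sigmoid (2 * r) ^ F.ncard * Real.sigmoid (2 * r) ^ 2 := by
        gcongr
        exact hμ.real_cyl_le_pow hs hr hF_fin x
    _ = Real.sigmoid (2 * r) ^ (F.ncard + 2) := (pow_add _ _ _).symm
    _ ≤ Real.sigmoid (2 * r) ^ B.ncard :=
        pow_le_pow_of_le_one (Real.sigmoid_pos _).le (Real.sigmoid_le_one _) h_card

section Consistency

open Asymptotics

/-- Radii `L n` and thresholds `ε n` for which the empirical probabilities of the boxes of radius
`L n` are accurate to any fixed multiple of `ε n` with probability tending to one. The number `q`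
bounds the conditional probability of a spin value given all other spins, so `q ^ boxVolume` bounds
the probability of a pattern on the box. -/
structure IsAdmissible (d : ℕ) (q : ℝ) (L ε : ℕ → ℝ) : Prop where
  tendsto_radius : Tendsto L atTop atTop
  eventually_pos : ∀ᶠ n in atTop, 0 < ε n
  volume_isLittleO : (fun n => (boxVolume d (L n) : ℝ)) =o[atTop] fun n => n * ε n
  volume_mul_pow_isLittleO :
    (fun n => boxVolume d (L n) * q ^ boxVolume d (L n)) =o[atTop] fun n => n * ε n ^ 2

variable {Ω : Type*} [MeasurableSpace Ω] {P : Measure Ω} [IsProbabilityMeasure P]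

theorem tendsto_measure_one_of_compl_subset {S T : ℕ → Set Ω}
    (hST : ∀ᶠ n in atTop, (T n)ᶜ ⊆ S n) (hT : Tendsto (fun n => P.real (T n)) atTop (𝓝 0)) :
    Tendsto (fun n => P (S n)) atTop (𝓝 1) := by
  have hT' : Tendsto (fun n => P (T n)) atTop (𝓝 0) :=
    (ENNReal.tendsto_toReal_zero_iff fun n => measure_ne_top P (T n)).1 hT
  have h_lower : Tendsto (fun n => 1 - P (T n)) atTop (𝓝 1) := by
    simpa only [tsub_zero] using
      ENNReal.Tendsto.sub (tendsto_const_nhds (x := 1)) hT' (Or.inl ENNReal.one_ne_top)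
  refine tendsto_of_tendsto_of_tendsto_of_le_of_le' h_lower tendsto_const_nhds ?_
    (Eventually.of_forall fun n => prob_le_one)
  filter_upwards [hST] with n hn
  calc 1 - P (T n) ≤ P (T n)ᶜ := by
        rw [tsub_le_iff_left, ← measure_univ (μ := P), ← Set.union_compl_self (T n)]
        exact measure_union_le _ _
    _ ≤ P (S n) := measure_mono hn

variable {J : Site d → Site d → ℝ} {μ : Measure (Config d)} {X : ℕ → Ω → Config d} {r : ℝ}
  {L ε : ℕ → ℝ} {i j : Site d}

theorem IsIsingLaw.tendsto_real_not_isTypical (hμ : IsIsingLaw J μ) (hX : IsIIDSample X P μ)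
    (hs : ∀ i, Summable fun j => |J i j|) (hr : ∀ i, ∑' j, |J i j| ≤ r) (hd : 1 ≤ d)
    (h : IsAdmissible d (Real.sigmoid (2 * r)) L ε) {c : ℝ} (hc : 0 < c) (i j : Site d) :
    Tendsto (fun n => P.real {ω | ¬ IsTypical μ (Set.Icc (box (L n) i \ {i, j}) (box (L n) i))
      (c * ε n) (fun k => X k ω) n}) atTop (𝓝 0) := by
  set q := Real.sigmoid (2 * r)
  have h_card : (fun n => boxVolume d (L n)) =ᶠ[atTop] fun n => (box (L n) i).ncard := by
    filter_upwards [h.tendsto_radius.eventually_ge_atTop 0] with n hn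
    exact (ncard_box hn i).symm
  have h_lin : (fun n => ((box (L n) i).ncard : ℝ)) =o[atTop] fun n => n * (c * ε n) := by
    simp only [mul_left_comm _ c]
    exact (h.volume_isLittleO.const_mul_right hc.ne').congr' (h_card.fun_comp _) .rfl
  have h_quad : (fun n => (box (L n) i).ncard * (q ^ (box (L n) i).ncard / q ^ 2)) =o[atTop]
      fun n => n * (c * ε n) ^ 2 := by
    simp only [mul_pow, mul_left_comm _ (c ^ 2), ← mul_div_assoc]
    simp only [div_eq_inv_mul]
    exact ((h.volume_mul_pow_isLittleO.const_mul_left (q ^ 2)⁻¹).const_mul_right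
      (pow_ne_zero 2 hc.ne')).congr'
        (h_card.fun_comp fun m : ℕ => (q ^ 2)⁻¹ * (m * q ^ m)) .rfl
  refine hX.tendsto_real_not_isTypical (fun n => finite_box (L n) i)
    (Eventually.of_forall fun n F hF => hF.2)
    (Eventually.of_forall fun n F hF => hμ.real_cyl_le_pow_div hs hr (finite_box (L n) i) hF)
    ?_ ((tendsto_boxVolume hd h.tendsto_radius).congr' h_card) h_lin h_quad
  filter_upwards [h.eventually_pos] with n hn using mul_pos hc hn

theorem IsIsingLaw.tendsto_measure_mem_estimator (hμ : IsIsingLaw J μ) (hX : IsIIDSample X P μ)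
    (hs : ∀ i, Summable fun j => |J i j|) (hr : ∀ i, ∑' j, |J i j| ≤ r) (hd : 1 ≤ d)
    (h : IsAdmissible d (Real.sigmoid (2 * r)) L ε)
    (hε : ε =o[atTop] fun n => (1 / 2 : ℝ) ^ boxVolume d (L n)) (hii : J i i = 0)
    (hij : J i j ≠ 0) :
    Tendsto (fun n => P {ω | j ∈ estimator (fun k => X k ω) n (L n) (ε n) i}) atTop (𝓝 1) := by
  have h_ne : i ≠ j := fun h => hij (h ▸ hii)
  have hσ : 0 < Real.sigmoid (-(2 * r)) := Real.sigmoid_pos _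
  set κ := Real.sigmoid (-(2 * r)) ^ 2 * (2 * |J i j|)
  have hκ : 0 < κ := by positivity
  have h_gap : 0 < κ * Real.sigmoid (-(2 * r)) := mul_pos hκ hσ
  refine tendsto_measure_one_of_compl_subset ?_
    (hμ.tendsto_real_not_isTypical hX hs hr hd h (show (0 : ℝ) < 1 / 8 by norm_num) i j)
  filter_upwards [h.eventually_pos, h.tendsto_radius.eventually_ge_atTop 0,
    h.tendsto_radius.eventually_ge_atTop ‖i - j‖, hε.def (half_pos h_gap),
    (tendsto_interactionOutside_box (J := J) (i := i)
      h.tendsto_radius).eventually_le_const (half_pos hκ)]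
    with n hε_pos hL hj hε_le h_out ω hω
  obtain ⟨x, hx⟩ := hμ.exists_le_empDist hs hr hii hκ.le (by linarith)
    (box_eq_insert_insert hj) (finite_box _ _) (by simp [h_ne]) (by simp) (not_not.1 hω)
  rw [ncard_box hL] at hx
  rw [Real.norm_of_nonneg hε_pos.le, Real.norm_of_nonneg (by positivity)] at hε_le
  exact mem_estimator_of_lt_empDist hj (by linarith)

theorem IsIsingLaw.tendsto_measure_notMem_estimator (hμ : IsIsingLaw J μ)
    (hX : IsIIDSample X P μ) (hs : ∀ i, Summable fun j => |J i j|)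
    (hr : ∀ i, ∑' j, |J i j| ≤ r) (hd : 1 ≤ d) (h : IsAdmissible d (Real.sigmoid (2 * r)) L ε)
    (hε : (fun n => interactionOutside J i (box (L n) i)) =o[atTop] ε) (hii : J i i = 0)
    (hij : J i j = 0) :
    Tendsto (fun n => P {ω | j ∉ estimator (fun k => X k ω) n (L n) (ε n) i}) atTop (𝓝 1) := by
  refine tendsto_measure_one_of_compl_subset ?_
    (hμ.tendsto_real_not_isTypical hX hs hr hd h (show (0 : ℝ) < 1 / 8 by norm_num) i j)
  filter_upwards [h.eventually_pos, hε.def (show (0 : ℝ) < 1 / 4 by norm_num)]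
    with n hε_pos h_out ω hω
  refine notMem_estimator_of_forall_empDist_le hε_pos.le fun hj x => ?_
  rcases eq_or_ne i j with rfl | h_ne
  · exact (empDist_self ..).trans_le hε_pos.le
  have h_le := hμ.empDist_le (hs i) hii hij (box_eq_insert_insert hj) (by simp [h_ne]) (by simp)
    (not_not.1 hω) x
  rw [Real.norm_of_nonneg (interactionOutside_nonneg ..), Real.norm_of_nonneg hε_pos.le] at h_out
  linarith

end Consistency

section ExpRate

open Asymptotics

variable {ι : Type*} {𝓕 : Filter ι} {m a b u : ι → ℝ} {k l c : ℝ}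

/-- The positive function `a` grows like `exp (l * m)` on the logarithmic scale along `𝓕`. -/
structure HasExpRate (𝓕 : Filter ι) (m a : ι → ℝ) (l : ℝ) : Prop where
  eventually_pos : ∀ᶠ n in 𝓕, 0 < a n
  tendsto_log_div : Tendsto (fun n => Real.log (a n) / m n) 𝓕 (𝓝 l)

namespace HasExpRate

theorem exp (h : Tendsto (fun n => u n / m n) 𝓕 (𝓝 l)) :
    HasExpRate 𝓕 m (fun n => Real.exp (u n)) l :=
  ⟨Eventually.of_forall fun _ => Real.exp_pos _, by simpa only [Real.log_exp] using h⟩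

theorem const_rpow (hc : 0 < c) (h : Tendsto (fun n => u n / m n) 𝓕 (𝓝 l)) :
    HasExpRate 𝓕 m (fun n => c ^ u n) (l * Real.log c) := by
  simp only [Real.rpow_def_of_pos hc]
  exact exp ((h.mul_const (Real.log c)).congr fun n => by ring)

theorem of_tendsto (hm : Tendsto m 𝓕 atTop) (hc : 0 < c) (h : Tendsto a 𝓕 (𝓝 c)) :
    HasExpRate 𝓕 m a 0 :=
  ⟨h.eventually_const_lt hc, (h.log hc.ne').div_atTop hm⟩

theorem self (hm : Tendsto m 𝓕 atTop) : HasExpRate 𝓕 m m 0 :=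
  ⟨hm.eventually_gt_atTop 0, Real.isLittleO_log_id_atTop.tendsto_div_nhds_zero.comp hm⟩

theorem mul (ha : HasExpRate 𝓕 m a k) (hb : HasExpRate 𝓕 m b l) :
    HasExpRate 𝓕 m (fun n => a n * b n) (k + l) where
  eventually_pos := ha.eventually_pos.and hb.eventually_pos |>.mono fun _ h => mul_pos h.1 h.2
  tendsto_log_div := by
    refine (ha.tendsto_log_div.add hb.tendsto_log_div).congr' ?_
    filter_upwards [ha.eventually_pos, hb.eventually_pos] with n han hbn
    rw [Real.log_mul han.ne' hbn.ne', add_div]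

theorem inv (ha : HasExpRate 𝓕 m a l) : HasExpRate 𝓕 m (fun n => (a n)⁻¹) (-l) where
  eventually_pos := ha.eventually_pos.mono fun _ h => inv_pos.2 h
  tendsto_log_div := by simpa only [Real.log_inv, neg_div] using ha.tendsto_log_div.neg

theorem div (ha : HasExpRate 𝓕 m a k) (hb : HasExpRate 𝓕 m b l) :
    HasExpRate 𝓕 m (fun n => a n / b n) (k - l) := by
  simpa only [div_eq_mul_inv, sub_eq_add_neg] using ha.mul hb.inv

theorem sqrt (ha : HasExpRate 𝓕 m a l) : HasExpRate 𝓕 m (fun n => √(a n)) (l / 2) where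
  eventually_pos := ha.eventually_pos.mono fun _ h => Real.sqrt_pos.2 h
  tendsto_log_div := by
    refine (ha.tendsto_log_div.div_const 2).congr' ?_
    filter_upwards [ha.eventually_pos] with n han
    rw [Real.log_sqrt han.le, div_right_comm]

theorem isLittleO (ha : HasExpRate 𝓕 m a k) (hb : HasExpRate 𝓕 m b l)
    (hm : Tendsto m 𝓕 atTop) (hkl : k < l) : a =o[𝓕] b := by
  have h_diff := (ha.div hb).tendsto_log_div
  have h_exp := Real.tendsto_exp_atBot.comp (hm.atTop_mul_neg (sub_neg.2 hkl) h_diff)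
  refine (isLittleO_iff_tendsto' (hb.eventually_pos.mono fun _ h h0 => absurd h0 h.ne')).2
    (h_exp.congr' ?_)
  filter_upwards [(ha.div hb).eventually_pos, hm.eventually_gt_atTop 0] with n hn hmn
  rw [Function.comp_apply, mul_div_cancel₀ _ hmn.ne', Real.exp_log hn]

end HasExpRate

end ExpRate

section Tuning

open Asymptotics

/-- The scale `(2 * radius d n) ^ d` on which all quantities of the theorem are exponential. -/
noncomputable def volScale (n : ℕ) : ℝ := 0.79 * Real.log n

theorem volScale_nonneg (n : ℕ) : 0 ≤ volScale n :=
  mul_nonneg (by norm_num) (Real.log_natCast_nonneg n)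

theorem tendsto_volScale : Tendsto volScale atTop atTop :=
  (Real.tendsto_log_atTop.comp tendsto_natCast_atTop_atTop).const_mul_atTop (by norm_num)

theorem radius_nonneg (d n : ℕ) : 0 ≤ radius d n :=
  mul_nonneg (by norm_num) (Real.rpow_nonneg (volScale_nonneg n) _)

theorem two_mul_radius_pow (hd : 1 ≤ d) (n : ℕ) : (2 * radius d n) ^ d = volScale n := by
  have h_root : 2 * radius d n = volScale n ^ (d : ℝ)⁻¹ := by
    rw [radius, volScale, one_div, mul_inv_cancel_left₀ two_ne_zero, one_div]
  rw [h_root, Real.rpow_inv_natCast_pow (volScale_nonneg n) (by omega)]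

theorem tendsto_radius (hd : 1 ≤ d) : Tendsto (radius d) atTop atTop :=
  ((tendsto_rpow_atTop (show (0 : ℝ) < 1 / d by positivity)).comp
    tendsto_volScale).const_mul_atTop (by norm_num)

theorem tendsto_pow_div_volScale (hd : 1 ≤ d) {u : ℕ → ℝ}
    (hu : Tendsto (fun n => u n / radius d n) atTop (𝓝 2)) :
    Tendsto (fun n => u n ^ d / volScale n) atTop (𝓝 1) := by
  have h_pow := (hu.div_const 2).pow d
  rw [div_self two_ne_zero, one_pow] at h_pow
  refine h_pow.congr fun n => ?_
  rw [← two_mul_radius_pow hd, ← div_pow, div_div, mul_comm]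

theorem tendsto_two_mul_floor_radius_div (hd : 1 ≤ d) :
    Tendsto (fun n => 2 * (⌊radius d n⌋₊ : ℝ) / radius d n) atTop (𝓝 2) := by
  simpa only [Function.comp_apply, mul_one, mul_div_assoc] using
    (tendsto_nat_floor_div_atTop.comp (tendsto_radius hd)).const_mul 2

theorem tendsto_boxVolume_div_volScale (hd : 1 ≤ d) :
    Tendsto (fun n => (boxVolume d (radius d n) : ℝ) / volScale n) atTop (𝓝 1) := by
  simp only [boxVolume, Nat.cast_pow, Nat.cast_add, Nat.cast_mul, Nat.cast_ofNat, Nat.cast_one]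
  refine tendsto_pow_div_volScale hd ?_
  simpa only [add_div, add_zero] using (tendsto_two_mul_floor_radius_div hd).add
    (tendsto_const_nhds.div_atTop (tendsto_radius hd))

theorem hasExpRate_natCast : HasExpRate atTop volScale (fun n : ℕ => (n : ℝ)) (1 / 0.79) where
  eventually_pos := tendsto_natCast_atTop_atTop.eventually_gt_atTop 0
  tendsto_log_div := by
    refine tendsto_const_nhds.congr' ?_
    filter_upwards [tendsto_volScale.eventually_gt_atTop 0] with n hn
    rw [eq_div_iff hn.ne', volScale]
    ring

theorem hasExpRate_boxVolume (hd : 1 ≤ d) :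
    HasExpRate atTop volScale (fun n => (boxVolume d (radius d n) : ℝ)) 0 := by
  refine ⟨Eventually.of_forall fun n => by rw [boxVolume]; positivity, ?_⟩
  have h := ((HasExpRate.of_tendsto tendsto_volScale one_pos
    (tendsto_boxVolume_div_volScale hd)).mul (.self tendsto_volScale)).tendsto_log_div
  rw [add_zero] at h
  refine h.congr' ?_
  filter_upwards [tendsto_volScale.eventually_gt_atTop 0] with n hn
  rw [div_mul_cancel₀ _ hn.ne']

theorem hasExpRate_pow_boxVolume (hd : 1 ≤ d) {q : ℝ} (hq : 0 < q) :
    HasExpRate atTop volScale (fun n => q ^ boxVolume d (radius d n)) (Real.log q) := by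
  simpa only [Real.rpow_natCast, one_mul] using
    HasExpRate.const_rpow hq (tendsto_boxVolume_div_volScale hd)

theorem hasExpRate_exp_neg_floor (hd : 1 ≤ d) :
    HasExpRate atTop volScale (fun n => Real.exp (-(2 * (⌊radius d n⌋₊ : ℝ)) ^ d)) (-1) := by
  refine HasExpRate.exp ?_
  simpa only [neg_div] using
    (tendsto_pow_div_volScale hd (tendsto_two_mul_floor_radius_div hd)).neg

theorem one_add_exp_div_exp (t : ℝ) : (1 + Real.exp t) / Real.exp t = (Real.sigmoid t)⁻¹ := by
  rw [Real.sigmoid_def, inv_inv, add_div, div_self (Real.exp_ne_zero t), one_div, Real.exp_neg,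
    add_comm]

/-- The exponential rate of `threshold d C (radius d n) n` on the scale `volScale`. -/
noncomputable def thresholdRate : ℝ := (Real.log (Real.sigmoid 2) - 1 / 0.79) / 2

theorem hasExpRate_threshold (hd : 1 ≤ d) {C : ℝ} (hC : 0 < C) :
    HasExpRate atTop volScale (fun n => threshold d C (radius d n) n) thresholdRate := by
  have h_one : Tendsto (fun n => -volScale n / volScale n) atTop (𝓝 (-1)) := by
    refine tendsto_const_nhds.congr' ?_
    filter_upwards [tendsto_volScale.eventually_gt_atTop 0] with n hn
    rw [neg_div, div_self hn.ne']
  have h := (HasExpRate.of_tendsto tendsto_volScale hC tendsto_const_nhds).mul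
    ((((HasExpRate.self tendsto_volScale).div hasExpRate_natCast).mul
      (.const_rpow (inv_pos.2 (Real.sigmoid_pos 2)) h_one)).sqrt)
  have h_rate : 0 + (0 - 1 / 0.79 + -1 * Real.log (Real.sigmoid 2)⁻¹) / 2 = thresholdRate := by
    rw [Real.log_inv, thresholdRate]
    ring
  simpa only [threshold, two_mul_radius_pow hd, one_add_exp_div_exp, h_rate] using h

theorem log_sigmoid (t : ℝ) : Real.log (Real.sigmoid t) = -Real.log (1 + Real.exp (-t)) := by
  rw [Real.sigmoid_def, Real.log_inv]

theorem exp_neg_two_gt : (0.135 : ℝ) < Real.exp (-2) :=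
  calc (0.135 : ℝ) < 0.36787944116 ^ 2 := by norm_num
    _ < Real.exp (-1) ^ 2 := by gcongr; exact Real.exp_neg_one_gt_d9
    _ = Real.exp (-2) := by rw [← Real.exp_nat_mul]; norm_num

theorem exp_neg_two_lt : Real.exp (-2) < 0.136 :=
  calc Real.exp (-2) = Real.exp (-1) ^ 2 := by rw [← Real.exp_nat_mul]; norm_num
    _ < 0.3678794412 ^ 2 := by gcongr; exact Real.exp_neg_one_lt_d9
    _ < 0.136 := by norm_num

theorem neg_one_lt_thresholdRate : -1 < thresholdRate := by
  have h_log : Real.log (1 + Real.exp (-2)) ≤ Real.exp (-2) := by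
    linarith [Real.log_le_sub_one_of_pos (show 0 < 1 + Real.exp (-2) by positivity)]
  rw [thresholdRate, log_sigmoid]
  linarith [exp_neg_two_lt]

theorem thresholdRate_lt_neg_log_two : thresholdRate < -Real.log 2 := by
  have h_log : 2 * Real.exp (-2) / (Real.exp (-2) + 2) ≤ Real.log (1 + Real.exp (-2)) :=
    Real.le_log_one_add_of_nonneg (Real.exp_pos _).le
  have h_lower : 0.126 < 2 * Real.exp (-2) / (Real.exp (-2) + 2) := by
    rw [lt_div_iff₀ (by positivity)]
    linarith [exp_neg_two_gt]
  rw [thresholdRate, log_sigmoid]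
  linarith [Real.log_two_lt_d9]

theorem isAdmissible_radius_threshold (hd : 1 ≤ d) {C q : ℝ} (hC : 0 < C) (hq : 0 < q)
    (hq_lt : q < Real.sigmoid 2) :
    IsAdmissible d q (radius d) (fun n => threshold d C (radius d n) n) where
  tendsto_radius := tendsto_radius hd
  eventually_pos := (hasExpRate_threshold hd hC).eventually_pos
  volume_isLittleO := by
    refine (hasExpRate_boxVolume hd).isLittleO
      (hasExpRate_natCast.mul (hasExpRate_threshold hd hC)) tendsto_volScale ?_
    linarith [neg_one_lt_thresholdRate]
  volume_mul_pow_isLittleO := by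
    have h_log : Real.log q < Real.log (Real.sigmoid 2) := Real.log_lt_log hq hq_lt
    have hε := hasExpRate_threshold hd hC
    simp only [pow_two]
    refine ((hasExpRate_boxVolume hd).mul (hasExpRate_pow_boxVolume hd hq)).isLittleO
      (hasExpRate_natCast.mul (hε.mul hε)) tendsto_volScale ?_
    rw [thresholdRate]
    linarith

theorem threshold_isLittleO_one_half_pow (hd : 1 ≤ d) {C : ℝ} (hC : 0 < C) :
    (fun n => threshold d C (radius d n) n) =o[atTop]
      fun n => (1 / 2 : ℝ) ^ boxVolume d (radius d n) :=
  (hasExpRate_threshold hd hC).isLittleO (hasExpRate_pow_boxVolume hd one_half_pos)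
    tendsto_volScale (by rw [one_div, Real.log_inv]; exact thresholdRate_lt_neg_log_two)

theorem exp_neg_floor_isLittleO_threshold (hd : 1 ≤ d) {C : ℝ} (hC : 0 < C) :
    (fun n => Real.exp (-(2 * (⌊radius d n⌋₊ : ℝ)) ^ d)) =o[atTop]
      fun n => threshold d C (radius d n) n :=
  (hasExpRate_exp_neg_floor hd).isLittleO (hasExpRate_threshold hd hC) tendsto_volScale
    neg_one_lt_thresholdRate

end Tuning

section Potential

open Asymptotics

variable {J : Site d → Site d → ℝ}

theorem summable_abs_of_iSup_lt_one (hr : (⨆ i, ∑' j, ENNReal.ofReal |J i j|) < 1) (i : Site d) :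
    Summable fun j => |J i j| := by
  have h : ∑' j, ENNReal.ofReal |J i j| ≠ ∞ :=
    ((le_iSup (fun i => ∑' j, ENNReal.ofReal |J i j|) i).trans_lt
      (hr.trans ENNReal.one_lt_top)).ne
  simpa only [ENNReal.toReal_ofReal (abs_nonneg _)] using ENNReal.summable_toReal h

theorem exists_lt_one_forall_tsum_le (hr : (⨆ i, ∑' j, ENNReal.ofReal |J i j|) < 1) :
    ∃ r < 1, ∀ i, ∑' j, |J i j| ≤ r := by
  have h_ne_top := (hr.trans ENNReal.one_lt_top).ne
  refine ⟨(⨆ i, ∑' j, ENNReal.ofReal |J i j|).toReal, ?_, fun i => ?_⟩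
  · rwa [← ENNReal.toReal_one, ENNReal.toReal_lt_toReal h_ne_top ENNReal.one_ne_top]
  · rw [← ENNReal.ofReal_le_iff_le_toReal h_ne_top,
      ENNReal.ofReal_tsum_of_nonneg (fun _ => abs_nonneg _) (summable_abs_of_iSup_lt_one hr i)]
    exact le_iSup (fun i => ∑' j, ENNReal.ofReal |J i j|) i

theorem interactionOutside_box (J : Site d → Site d → ℝ) (i : Site d) (L : ℝ) :
    interactionOutside J i (box L i) = ∑' j : {j : Site d // L < ‖j - i‖}, |J i j| := by
  have h_compl : (box L i)ᶜ = {j | L < ‖j - i‖} := by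
    ext j
    simp [box, norm_sub_rev i j]
  rw [interactionOutside, h_compl]
  rfl

theorem interactionOutside_box_isBigO (hs : ∀ i, Summable fun j => |J i j|)
    (htail : Tendsto
      (fun L : ℕ => ⨆ i : Site d, ∑' j : {j : Site d // (L : ℝ) < ‖j - i‖},
        ENNReal.ofReal (|J i j| * Real.exp ((2 * (L : ℝ)) ^ d)))
      atTop (𝓝 0)) (i : Site d) :
    (fun L : ℕ => interactionOutside J i (box L i)) =O[atTop]
      fun L => Real.exp (-(2 * (L : ℝ)) ^ d) := by
  refine IsBigO.of_bound 1 ?_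
  filter_upwards [htail.eventually_le_const zero_lt_one] with L hL
  have h_site := (le_iSup (fun i : Site d => ∑' j : {j : Site d // (L : ℝ) < ‖j - i‖},
    ENNReal.ofReal (|J i j| * Real.exp ((2 * (L : ℝ)) ^ d))) i).trans hL
  have h_sum : Summable fun j : {j : Site d // (L : ℝ) < ‖j - i‖} => |J i j| :=
    (hs i).subtype _
  rw [← ENNReal.ofReal_tsum_of_nonneg (fun _ => by positivity) (h_sum.mul_right _),
    ENNReal.ofReal_le_one, tsum_mul_right] at h_site
  rw [Real.norm_of_nonneg (interactionOutside_nonneg ..), Real.norm_of_nonneg (Real.exp_pos _).le,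
    one_mul, Real.exp_neg, interactionOutside_box, ← one_div, le_div_iff₀ (Real.exp_pos _)]
  exact h_site

theorem interactionOutside_box_radius_isLittleO (hd : 1 ≤ d) {C : ℝ} (hC : 0 < C) {i : Site d}
    (htail : (fun L : ℕ => interactionOutside J i (box L i)) =O[atTop]
      fun L => Real.exp (-(2 * (L : ℝ)) ^ d)) :
    (fun n => interactionOutside J i (box (radius d n) i)) =o[atTop]
      fun n => threshold d C (radius d n) n := by
  have h_floor : Tendsto (fun n => ⌊radius d n⌋₊) atTop atTop :=
    tendsto_nat_floor_atTop.comp (tendsto_radius hd)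
  refine ((htail.comp_tendsto h_floor).congr_left fun n => ?_).trans_isLittleO
    (exp_neg_floor_isLittleO_threshold hd hC)
  rw [Function.comp_apply, box_floor (radius_nonneg d n)]

end Potential

end IsingNeighborhood

theorem mainTheorem2_general {d : ℕ} (hd : 1 ≤ d) (J : Site d → Site d → ℝ)
    (hr : (⨆ i, ∑' j, ENNReal.ofReal |J i j|) < 1) (μ : Measure (Config d))
    (hμ : IsIsingLaw J μ) {Ω : Type*} [MeasurableSpace Ω] (P : Measure Ω) [IsProbabilityMeasure P]
    (X : ℕ → Ω → Config d) (hX : IsIIDSample X P μ) (C : ℝ) (hC : 0 < C) (i : Site d)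
    (hii : J i i = 0) :
    (∀ j ∈ interactionNbhd J i,
      Tendsto (fun n : ℕ => P {ω | j ∈ estimator (fun k => X k ω) n (radius d n)
        (threshold d C (radius d n) n) i}) atTop (𝓝 1)) ∧
    ((fun L : ℕ => interactionOutside J i (box L i)) =O[atTop]
        (fun L => Real.exp (-(2 * (L : ℝ)) ^ d)) →
      ∀ j ∉ interactionNbhd J i,
        Tendsto (fun n : ℕ => P {ω | j ∉ estimator (fun k => X k ω) n (radius d n)
          (threshold d C (radius d n) n) i}) atTop (𝓝 1)) := by
  have hs := summable_abs_of_iSup_lt_one hr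
  obtain ⟨r, hr_lt, hr_le⟩ := exists_lt_one_forall_tsum_le hr
  have h_adm := isAdmissible_radius_threshold hd hC (Real.sigmoid_pos (2 * r))
    (Real.sigmoid_strictMono (by linarith : 2 * r < 2))
  refine ⟨fun j hj => ?_, fun htail j hj => ?_⟩
  · exact hμ.tendsto_measure_mem_estimator hX hs hr_le hd h_adm
      (threshold_isLittleO_one_half_pow hd hC) hii hj
  · exact hμ.tendsto_measure_notMem_estimator hX hs hr_le hd h_adm
      (interactionOutside_box_radius_isLittleO hd hC htail) hii (not_not.1 hj)

theorem mainTheorem2 {d : ℕ} (hd : 1 ≤ d) (J : Site d → Site d → ℝ)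
    (hJ : IsPairwisePotential J)
    (hr : (⨆ i, ∑' j, ENNReal.ofReal |J i j|) < 1)
    (htail : Tendsto
      (fun L : ℕ => ⨆ i : Site d, ∑' j : {j : Site d // (L : ℝ) < ‖j - i‖},
        ENNReal.ofReal (|J i j| * Real.exp ((2 * (L : ℝ)) ^ d)))
      atTop (𝓝 0))
    (μ : Measure (Config d)) (hμ : IsIsingLaw J μ)
    {Ω : Type*} [MeasurableSpace Ω] (P : Measure Ω) [IsProbabilityMeasure P]
    (X : ℕ → Ω → Config d) (hXm : ∀ k, Measurable (X k))
    (hXlaw : ∀ k, P.map (X k) = μ) (hXindep : iIndepFun X P)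
    (C : ℝ) (hC : 0 < C) (i : Site d) :
    (∀ j ∈ interactionNbhd J i,
      Tendsto (fun n : ℕ => P {ω | j ∈ estimator (fun k => X k ω) n (radius d n)
        (threshold d C (radius d n) n) i}) atTop (𝓝 1)) ∧
    (∀ j ∉ interactionNbhd J i,
      Tendsto (fun n : ℕ => P {ω | j ∉ estimator (fun k => X k ω) n (radius d n)
        (threshold d C (radius d n) n) i}) atTop (𝓝 1)) := by
  have h := mainTheorem2_general hd J hr μ hμ P X ⟨hXm, hXlaw, hXindep⟩ C hC i (hJ.diag_zero i)
  exact ⟨h.1, h.2 (interactionOutside_box_isBigO (summable_abs_of_iSup_lt_one hr) htail i)⟩
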